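/- Let $q\in(0,1)$ and let $k,l$ be coprime positive integers. Let $\mathcal O(S^3_q)$ be the unital complex $*$-algebra generated by $\alpha,\beta$ with relations $$\alpha\beta=q\beta\alpha,\quad \alpha\beta^*=q\beta^*\alpha,\quad \beta\beta^*=\beta^*\beta,\quad \alpha\alpha^*=\alpha^*\alpha+(q^{-2}-1)\beta\beta^*,\quad \alpha\alpha^*+\beta\beta^*=1,$$ let $\varrho_{k,l}:\mathcal O(S^3_q)\to\mathcal O(S^3_q)\otimes\mathbb C[u,u^*]$ ($u$ unitary) be the $*$-homomorphism with $\alpha\mapsto\alpha\otimes u^k$ and $\beta\mapsto\beta\otimes u^{-l}$, and let $\mathcal O(\mathbb{WP}_q(k,l))=\{x:\varrho_{k,l}(x)=x\otimes 1\}$, a unital $*$-subalgebra containing $a=\beta\beta^*$ and $b=\alpha^l\beta^k$. A bounded $*$-representation is a unital $*$-homomorphism into the bounded operators on a complex Hilbert space; it is irreducible if the space is nonzero and has no closed invariant subspaces other than $0$ and itself. Let $(e_p)_{p\in\mathbb N}$, $\mathbb N=\{0,1,2,\dots\}$, be the standard orthonormal basis of $\ell^2(\mathbb N)$. Then the following is,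 up to unitary equivalence, the list of all bounded irreducible $*$-representations of $\mathcal O(\mathbb{WP}_q(k,l))$: (i) the one-dimensional representation $\pi_0$ on $\mathbb C$ with $\pi_0(a)=0$, $\pi_0(b)=0$; (ii) for $s=1,\dots,l$, the infinite-dimensional representation $\pi_s$ on $\ell^2(\mathbb N)$ with $$\pi_s(a)e_p=q^{2(lp+s)}e_p\ (p\ge 0),\qquad \pi_s(b)e_p=q^{k(lp+s)}\prod_{r=1}^{l}\bigl(1-q^{2(lp+s-r)}\bigr)^{1/2}e_{p-1}\ (p\ge 1),\qquad \pi_s(b)e_0=0.$$ That is: each of these formulas defines exactly one bounded $*$-representation; $\pi_0,\pi_1,\dots,\pi_l$ are irreducible and pairwise not unitarily equivalent; and every bounded irreducible $*$-representation on a Hilbert space is unitarily equivalent to one of them. -/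

import Mathlib

open scoped TensorProduct LaurentPolynomial

noncomputable section

namespace QuantumTeardrop

/-! ### Free complex `*`-algebras -/

/-- The free unital complex `*`-algebra on a set `X`: the free algebra on letters `x = (x, false)`
and `x* = (x, true)`. (A type synonym, because the star that Mathlib puts on `FreeAlgebra ℂ Y` is
`ℂ`-linear, whereas the star here is conjugate-linear and swaps `x` and `x*`.) -/
def FreeStarAlgebra (X : Type) : Type := FreeAlgebra ℂ (X × Bool)

namespace FreeStarAlgebra

variable {X : Type}

instance : Ring (FreeStarAlgebra X) := inferInstanceAs (Ring (FreeAlgebra ℂ (X × Bool)))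

instance : Algebra ℂ (FreeStarAlgebra X) :=
  inferInstanceAs (Algebra ℂ (FreeAlgebra ℂ (X × Bool)))

/-- The letter `x` (for `c = false`) or `x*` (for `c = true`). -/
def letter (x : X) (c : Bool) : FreeStarAlgebra X := FreeAlgebra.ι ℂ (x, c)

/-- The generator `x`. -/
def gen (x : X) : FreeStarAlgebra X := letter x false

/-- The universal property of the underlying free algebra. -/
def liftAlg {B : Type*} [Ring B] [Algebra ℂ B] (f : X × Bool → B) : FreeStarAlgebra X →ₐ[ℂ] B :=
  FreeAlgebra.lift ℂ f

@[simp] theorem liftAlg_letter {B : Type*} [Ring B] [Algebra ℂ B] (f : X × Bool → B)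
    (x : X) (c : Bool) : liftAlg f (letter x c) = f (x, c) :=
  FreeAlgebra.lift_ι_apply f (x, c)

theorem induction {P : FreeStarAlgebra X → Prop}
    (hc : ∀ c : ℂ, P (algebraMap ℂ _ c)) (hl : ∀ x c, P (letter x c))
    (hm : ∀ a b, P a → P b → P (a * b)) (ha : ∀ a b, P a → P b → P (a + b))
    (a : FreeStarAlgebra X) : P a :=
  FreeAlgebra.induction ℂ (X × Bool) (motive := P) hc (fun y => hl y.1 y.2) hm ha a

/-- The opposite ring of the free `*`-algebra, with scalars acting through their complex conjugates.
Algebra homomorphisms into it are conjugate-linear antihomomorphisms. -/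
def ConjOp (X : Type) : Type := (FreeStarAlgebra X)ᵐᵒᵖ

instance : Ring (ConjOp X) := inferInstanceAs (Ring (FreeStarAlgebra X)ᵐᵒᵖ)

instance : Algebra ℂ (ConjOp X) :=
  ((algebraMap ℂ (FreeStarAlgebra X)ᵐᵒᵖ).comp (starRingEnd ℂ)).toAlgebra'
    (fun c x => Algebra.commutes (A := (FreeStarAlgebra X)ᵐᵒᵖ) (starRingEnd ℂ c) x)

/-- The conjugate-linear antihomomorphism that exchanges the letters `x` and `x*`. -/
def starHom : FreeStarAlgebra X →+* (FreeStarAlgebra X)ᵐᵒᵖ :=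
  (liftAlg (B := ConjOp X) (fun y => MulOpposite.op (letter y.1 (!y.2)))).toRingHom

theorem starHom_algebraMap (c : ℂ) :
    starHom (algebraMap ℂ (FreeStarAlgebra X) c)
      = MulOpposite.op (algebraMap ℂ (FreeStarAlgebra X) (star c)) :=
  (liftAlg (B := ConjOp X) (fun y => MulOpposite.op (letter y.1 (!y.2)))).commutes c

theorem starHom_letter (x : X) (c : Bool) :
    starHom (letter x c) = MulOpposite.op (letter x (!c)) :=
  liftAlg_letter (B := ConjOp X) (fun y => MulOpposite.op (letter y.1 (!y.2))) x c

instance : StarRing (FreeStarAlgebra X) where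
  star a := (starHom a).unop
  star_involutive a := by
    refine induction (P := fun a => (starHom (starHom a).unop).unop = a) ?_ ?_ ?_ ?_ a
    · intro c; simp [starHom_algebraMap]
    · intro x c; simp [starHom_letter]
    · intro a b ha hb; simp [ha, hb]
    · intro a b ha hb; simp [ha, hb]
  star_mul a b := by simp
  star_add a b := by simp

@[simp] theorem star_algebraMap' (c : ℂ) :
    star (algebraMap ℂ (FreeStarAlgebra X) c) = algebraMap ℂ _ (star c) :=
  congrArg MulOpposite.unop (starHom_algebraMap c)

@[simp] theorem star_letter (x : X) (c : Bool) :
    star (letter x c) = letter x (!c) :=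
  congrArg MulOpposite.unop (starHom_letter x c)

instance : StarModule ℂ (FreeStarAlgebra X) where
  star_smul c a := by
    rw [Algebra.smul_def, Algebra.smul_def, star_mul, star_algebraMap', Algebra.commutes]

end FreeStarAlgebra

/-! ### The quantum three-sphere -/

/-- The two generators of the coordinate `*`-algebra of the quantum three-sphere. -/
inductive SphereGen : Type
  | alpha
  | beta

open FreeStarAlgebra in
/-- The defining relations of the quantum three-sphere, together with their adjoints. -/
inductive SphereRel (q : ℝ) : FreeStarAlgebra SphereGen → FreeStarAlgebra SphereGen → Prop
  | comm₁ : SphereRel q (gen .alpha * gen .beta) ((q : ℂ) • (gen .beta * gen .alpha))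
  | comm₂ : SphereRel q (gen .alpha * star (gen .beta)) ((q : ℂ) • (star (gen .beta) * gen .alpha))
  | normal : SphereRel q (gen .beta * star (gen .beta)) (star (gen .beta) * gen .beta)
  | comm₃ : SphereRel q (gen .alpha * star (gen .alpha))
      (star (gen .alpha) * gen .alpha
        + ((q : ℂ) ^ (-2 : ℤ) - 1) • (gen .beta * star (gen .beta)))
  | sphere : SphereRel q
      (gen .alpha * star (gen .alpha) + gen .beta * star (gen .beta)) 1
  | adjoint {x y : FreeStarAlgebra SphereGen} (h : SphereRel q x y) : SphereRel q (star x) (star y)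

/-- The coordinate `*`-algebra `O(S³_q) = O(SU_q(2))`: the unital complex `*`-algebra generated by
`α`, `β` subject to the relations above. -/
def Sphere (q : ℝ) : Type := RingQuot (SphereRel q)

namespace Sphere

variable (q : ℝ)

instance : Ring (Sphere q) := inferInstanceAs (Ring (RingQuot (SphereRel q)))

instance : Algebra ℂ (Sphere q) := inferInstanceAs (Algebra ℂ (RingQuot (SphereRel q)))

instance : StarRing (Sphere q) :=
  RingQuot.starRing (SphereRel q) (fun _ _ h => SphereRel.adjoint h)

/-- The quotient map from the free `*`-algebra. -/
def mk : FreeStarAlgebra SphereGen →ₐ[ℂ] Sphere q := RingQuot.mkAlgHom ℂ (SphereRel q)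

theorem mk_surjective : Function.Surjective (mk q) := RingQuot.mkAlgHom_surjective ℂ (SphereRel q)

variable {q} in
theorem mk_rel {x y : FreeStarAlgebra SphereGen} (h : SphereRel q x y) : mk q x = mk q y :=
  RingQuot.mkAlgHom_rel ℂ h

theorem mk_star (x : FreeStarAlgebra SphereGen) : mk q (star x) = star (mk q x) := by
  have h : ∀ y, mk q y = (⟨Quot.mk _ y⟩ : RingQuot (SphereRel q)) := by
    intro y
    simp only [mk, RingQuot.mkAlgHom_def, RingQuot.mkRingHom_def]
    rfl
  rw [h, h]
  rfl

instance : StarModule ℂ (Sphere q) where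
  star_smul c x := by
    obtain ⟨x, rfl⟩ := mk_surjective q x
    rw [← map_smul, ← mk_star, star_smul, map_smul, mk_star]

/-- The generator `α`. -/
def α : Sphere q := mk q (FreeStarAlgebra.gen .alpha)

/-- The generator `β`. -/
def β : Sphere q := mk q (FreeStarAlgebra.gen .beta)

theorem alpha_beta : α q * β q = (q : ℂ) • (β q * α q) := by
  simpa [α, β, -Complex.coe_smul] using mk_rel (SphereRel.comm₁ (q := q))

theorem alpha_star_beta : α q * star (β q) = (q : ℂ) • (star (β q) * α q) := by
  simpa [α, β, mk_star, -Complex.coe_smul] using mk_rel (SphereRel.comm₂ (q := q))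

theorem beta_normal : β q * star (β q) = star (β q) * β q := by
  simpa [α, β, mk_star, -Complex.coe_smul] using mk_rel (SphereRel.normal (q := q))

theorem alpha_star_alpha :
    α q * star (α q) = star (α q) * α q + ((q : ℂ) ^ (-2 : ℤ) - 1) • (β q * star (β q)) := by
  simpa [α, β, mk_star, -Complex.coe_smul] using mk_rel (SphereRel.comm₃ (q := q))

theorem sphere_eq : α q * star (α q) + β q * star (β q) = 1 := by
  simpa [α, β, mk_star, -Complex.coe_smul] using mk_rel (SphereRel.sphere (q := q))

section lift

variable {B : Type*} [Ring B] [StarRing B] [Algebra ℂ B] [StarModule ℂ B]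

/-- The letters of the free `*`-algebra evaluated at two elements of a `*`-algebra. -/
def letterVal (x y : B) : SphereGen × Bool → B
  | (.alpha, false) => x
  | (.alpha, true) => star x
  | (.beta, false) => y
  | (.beta, true) => star y

theorem liftAlg_star (x y : B) (w : FreeStarAlgebra SphereGen) :
    FreeStarAlgebra.liftAlg (letterVal x y) (star w)
      = star (FreeStarAlgebra.liftAlg (letterVal x y) w) := by
  refine FreeStarAlgebra.induction (P := fun w => FreeStarAlgebra.liftAlg (letterVal x y) (star w)
      = star (FreeStarAlgebra.liftAlg (letterVal x y) w)) ?_ ?_ ?_ ?_ w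
  · intro c; rw [FreeStarAlgebra.star_algebraMap', AlgHomClass.commutes, AlgHomClass.commutes,
      algebraMap_star_comm]
  · rintro (_ | _) (_ | _) <;> simp [letterVal]
  · intro a b ha hb; simp [ha, hb]
  · intro a b ha hb; simp [ha, hb]

/-- The universal property of `O(S³_q)`: two elements of a `*`-algebra that satisfy the defining
relations determine a `*`-homomorphism. -/
def lift (x y : B) (h₁ : x * y = (q : ℂ) • (y * x)) (h₂ : x * star y = (q : ℂ) • (star y * x))
    (h₃ : y * star y = star y * y)
    (h₄ : x * star x = star x * x + ((q : ℂ) ^ (-2 : ℤ) - 1) • (y * star y))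
    (h₅ : x * star x + y * star y = 1) : Sphere q →⋆ₐ[ℂ] B :=
  let f : Sphere q →ₐ[ℂ] B := RingQuot.liftAlgHom ℂ
    ⟨FreeStarAlgebra.liftAlg (letterVal x y), fun a b h => by
      induction h with
      | adjoint _ ih => rw [liftAlg_star, liftAlg_star, ih]
      | comm₁ => simpa [FreeStarAlgebra.gen, letterVal, -Complex.coe_smul] using h₁
      | comm₂ => simpa [FreeStarAlgebra.gen, letterVal, -Complex.coe_smul] using h₂
      | normal => simpa [FreeStarAlgebra.gen, letterVal, -Complex.coe_smul] using h₃
      | comm₃ => simpa [FreeStarAlgebra.gen, letterVal, -Complex.coe_smul] using h₄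
      | sphere => simpa [FreeStarAlgebra.gen, letterVal, -Complex.coe_smul] using h₅⟩
  { f with
    map_star' := fun w => by
      obtain ⟨w, rfl⟩ := mk_surjective q w
      have hf : ∀ w, f (mk q w) = FreeStarAlgebra.liftAlg (letterVal x y) w := fun w =>
        RingQuot.liftAlgHom_mkAlgHom_apply ℂ _ _ w
      change f (star (mk q w)) = star (f (mk q w))
      rw [← mk_star, hf, hf, liftAlg_star] }

variable (x y : B) (h₁ : x * y = (q : ℂ) • (y * x)) (h₂ : x * star y = (q : ℂ) • (star y * x))
    (h₃ : y * star y = star y * y)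
    (h₄ : x * star x = star x * x + ((q : ℂ) ^ (-2 : ℤ) - 1) • (y * star y))
    (h₅ : x * star x + y * star y = 1)

@[simp] theorem lift_α : lift q x y h₁ h₂ h₃ h₄ h₅ (α q) = x :=
  (RingQuot.liftAlgHom_mkAlgHom_apply ℂ _ _ _).trans
    (FreeStarAlgebra.liftAlg_letter _ _ _)

@[simp] theorem lift_β : lift q x y h₁ h₂ h₃ h₄ h₅ (β q) = y :=
  (RingQuot.liftAlgHom_mkAlgHom_apply ℂ _ _ _).trans
    (FreeStarAlgebra.liftAlg_letter _ _ _)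

end lift

end Sphere

/-! ### The coaction of `ℂ[u, u*]` and the quantum weighted projective line -/

/-- The coefficientwise complex conjugation followed by `u ↦ u⁻¹`, on `ℂ[u, u⁻¹]`. -/
def laurentStar : ℂ[T;T⁻¹] →+* ℂ[T;T⁻¹] :=
  (LaurentPolynomial.invert (R := ℂ) : ℂ[T;T⁻¹] →+* ℂ[T;T⁻¹]).comp
    (AddMonoidAlgebra.mapRingHom ℤ (starRingEnd ℂ))

theorem laurentStar_apply (f : ℂ[T;T⁻¹]) :
    laurentStar f = LaurentPolynomial.invert (AddMonoidAlgebra.mapRingHom ℤ (starRingEnd ℂ) f) :=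
  rfl

theorem laurentStar_C (c : ℂ) :
    laurentStar (LaurentPolynomial.C c) = LaurentPolynomial.C (star c) := by
  rw [laurentStar_apply, ← LaurentPolynomial.single_eq_C, AddMonoidAlgebra.coe_mapRingHom,
    AddMonoidAlgebra.map_single, LaurentPolynomial.single_eq_C, LaurentPolynomial.invert_C]
  rfl

theorem laurentStar_T (n : ℤ) :
    laurentStar (LaurentPolynomial.T n) = LaurentPolynomial.T (-n) := by
  rw [laurentStar_apply, LaurentPolynomial.T, AddMonoidAlgebra.coe_mapRingHom,
    AddMonoidAlgebra.map_single,
    show (starRingEnd ℂ : ℂ →+ ℂ) 1 = 1 from map_one (starRingEnd ℂ)]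
  exact LaurentPolynomial.invert_T n

/-- The `*`-structure of the Hopf algebra `ℂ[u, u*]` of Laurent polynomials, with `u = T 1`
unitary: it is conjugate-linear and `star (T n) = T (-n)`. -/
instance laurentStarRing : StarRing ℂ[T;T⁻¹] where
  star f := laurentStar f
  star_involutive f := by
    induction f using LaurentPolynomial.induction_on' with
    | add p r hp hr => simp only [map_add] at hp hr ⊢; rw [hp, hr]
    | C_mul_T n c => simp [laurentStar_C, laurentStar_T]
  star_mul f g := by rw [map_mul, mul_comm]
  star_add f g := map_add _ f g

@[simp] theorem star_T (n : ℤ) :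
    star (LaurentPolynomial.T n : ℂ[T;T⁻¹]) = LaurentPolynomial.T (-n) :=
  laurentStar_T n

instance : StarModule ℂ ℂ[T;T⁻¹] where
  star_smul c f := by
    change laurentStar _ = _ • laurentStar _
    rw [LaurentPolynomial.smul_eq_C_mul, LaurentPolynomial.smul_eq_C_mul, map_mul, laurentStar_C]

/-- The coaction `ϱ_{k,l} : O(S³_q) → O(S³_q) ⊗ ℂ[u, u*]`, the `*`-homomorphism with
`α ↦ α ⊗ u^k` and `β ↦ β ⊗ u^{-l}`. -/
def coaction (q : ℝ) (k l : ℕ) : Sphere q →⋆ₐ[ℂ] Sphere q ⊗[ℂ] ℂ[T;T⁻¹] :=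
  Sphere.lift q (Sphere.α q ⊗ₜ LaurentPolynomial.T (k : ℤ))
    (Sphere.β q ⊗ₜ LaurentPolynomial.T (-(l : ℤ)))
    (by
      simp only [Algebra.TensorProduct.tmul_mul_tmul, ← LaurentPolynomial.T_add,
        Sphere.alpha_beta, TensorProduct.smul_tmul', add_comm])
    (by
      simp only [Algebra.TensorProduct.tmul_mul_tmul, TensorProduct.star_tmul, star_T,
        ← LaurentPolynomial.T_add, Sphere.alpha_star_beta, TensorProduct.smul_tmul', add_comm])
    (by
      simp only [Algebra.TensorProduct.tmul_mul_tmul, TensorProduct.star_tmul, star_T,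
        ← LaurentPolynomial.T_add, Sphere.beta_normal, add_comm])
    (by
      simp only [Algebra.TensorProduct.tmul_mul_tmul, TensorProduct.star_tmul, star_T,
        ← LaurentPolynomial.T_add, Sphere.alpha_star_alpha, TensorProduct.smul_tmul',
        TensorProduct.add_tmul, add_neg_cancel, neg_add_cancel])
    (by
      simp only [Algebra.TensorProduct.tmul_mul_tmul, TensorProduct.star_tmul, star_T,
        ← LaurentPolynomial.T_add, ← TensorProduct.add_tmul, add_neg_cancel, Sphere.sphere_eq,
        LaurentPolynomial.T_zero, Algebra.TensorProduct.one_def])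

/-- The coordinate algebra `O(WP_q(k,l))` of the quantum weighted projective line: the
`*`-subalgebra of the coinvariants `x` of the coaction, `ϱ_{k,l}(x) = x ⊗ 1`. -/
def WP (q : ℝ) (k l : ℕ) : StarSubalgebra ℂ (Sphere q) where
  carrier := {x | coaction q k l x = x ⊗ₜ[ℂ] (1 : ℂ[T;T⁻¹])}
  mul_mem' {x y} hx hy := by
    simp only [Set.mem_ofPred_eq] at hx hy ⊢
    rw [map_mul, hx, hy, Algebra.TensorProduct.tmul_mul_tmul, one_mul]
  add_mem' {x y} hx hy := by
    simp only [Set.mem_ofPred_eq] at hx hy ⊢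
    rw [map_add, hx, hy, TensorProduct.add_tmul]
  algebraMap_mem' c := by
    simp only [Set.mem_ofPred_eq]
    rw [AlgHomClass.commutes, Algebra.TensorProduct.algebraMap_apply]
  star_mem' {x} hx := by
    simp only [Set.mem_ofPred_eq] at hx ⊢
    rw [map_star, hx, TensorProduct.star_tmul, star_one]

/-- The element `a = β β*` of `O(WP_q(k,l))`. -/
def a (q : ℝ) (k l : ℕ) : WP q k l :=
  ⟨Sphere.β q * star (Sphere.β q), by
    change coaction q k l _ = _
    simp only [coaction, map_mul, map_star, Sphere.lift_β, TensorProduct.star_tmul, star_T,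
      Algebra.TensorProduct.tmul_mul_tmul, ← LaurentPolynomial.T_add, add_neg_cancel,
      LaurentPolynomial.T_zero]⟩

/-- The element `b = α^l β^k` of `O(WP_q(k,l))`. -/
def b (q : ℝ) (k l : ℕ) : WP q k l :=
  ⟨Sphere.α q ^ l * Sphere.β q ^ k, by
    change coaction q k l _ = _
    simp only [coaction, map_mul, map_pow, Sphere.lift_α, Sphere.lift_β,
      Algebra.TensorProduct.tmul_pow, Algebra.TensorProduct.tmul_mul_tmul,
      LaurentPolynomial.T_pow, ← LaurentPolynomial.T_add]
    rw [show (l : ℤ) * k + k * -(l : ℤ) = 0 by ring, LaurentPolynomial.T_zero]⟩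

/-! ### Bounded `*`-representations -/

/-- A bounded (unital) `*`-representation of a unital complex `*`-algebra on a Hilbert space. -/
abbrev BoundedRep (A : Type*) [Ring A] [StarRing A] [Algebra ℂ A]
    (H : Type*) [NormedAddCommGroup H] [InnerProductSpace ℂ H] [CompleteSpace H] : Type _ :=
  A →⋆ₐ[ℂ] (H →L[ℂ] H)

section Rep

variable {A : Type*} [Ring A] [StarRing A] [Algebra ℂ A]
  {H : Type*} [NormedAddCommGroup H] [InnerProductSpace ℂ H] [CompleteSpace H]
  {H' : Type*} [NormedAddCommGroup H'] [InnerProductSpace ℂ H'] [CompleteSpace H']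

/-- Irreducibility: the space is nonzero, and the only closed invariant subspaces are `0` and the
whole space. -/
def IsIrreducibleRep (π : BoundedRep A H) : Prop :=
  Nontrivial H ∧ ∀ K : Submodule ℂ H, IsClosed (K : Set H) →
    (∀ x : A, ∀ v ∈ K, π x v ∈ K) → K = ⊥ ∨ K = ⊤

/-- Unitary equivalence of representations. -/
def UnitarilyEquivalent (π : BoundedRep A H) (π' : BoundedRep A H') : Prop :=
  ∃ U : H ≃ₗᵢ[ℂ] H', ∀ (x : A) (v : H), U (π x v) = π' x (U v)

end Rep

/-- The Hilbert space `ℓ²(ℕ)`. -/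
abbrev L2 : Type := lp (fun _ : ℕ => ℂ) 2

/-- The standard orthonormal basis of `ℓ²(ℕ)`. -/
def e (p : ℕ) : L2 := lp.single 2 p (1 : ℂ)

/-- The weight `q^{k(lp+s)} ∏_{r=1}^{l} (1 - q^{2(lp+s-r)})^{1/2}`. -/
def weight (q : ℝ) (k l s p : ℕ) : ℝ :=
  q ^ (k * (l * p + s)) *
    ∏ r ∈ Finset.Icc 1 l, Real.sqrt (1 - q ^ (2 * ((l : ℤ) * p + s - r)))

/-- `π(a) e_p = q^{2(lp+s)} e_p`, `π(b) e_p = q^{k(lp+s)} ∏_r (1 - q^{2(lp+s-r)})^{1/2} e_{p-1}`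
for `p ≥ 1`, and `π(b) e_0 = 0`. -/
def IsTeardropRep (q : ℝ) (k l s : ℕ) (π : BoundedRep (WP q k l) L2) : Prop :=
  (∀ p : ℕ, π (a q k l) (e p) = ((q ^ (2 * (l * p + s)) : ℝ) : ℂ) • e p) ∧
  (∀ p : ℕ, 1 ≤ p → π (b q k l) (e p) = (weight q k l s p : ℂ) • e (p - 1)) ∧
  π (b q k l) (e 0) = 0

end QuantumTeardrop

end

noncomputable section

namespace QuantumTeardrop

open Polynomial

variable {q : ℝ} {k l s : ℕ}

/-! ### Moving powers past each other in q-commutation relations -/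

section QCommute

variable {R : Type*} [Ring R] [Algebra ℂ R]

/-! The algebra is generated by a and b (`WP_induction`): the monomials α^i β^j β*^m and α*^i β^j
β*^m span the sphere algebra and are homogeneous for the coaction, and coprimality of k and l makes
every monomial of weight zero a multiple of a word in a, b, b*. Moreover ba = q^{2l} ab, b*b = f(a)
and bb* = g(a) with explicit polynomials f, g, and the nonzero roots of f are q^2, q^4, …, q^{2l}.

In a bounded representation, b multiplies an eigenvalue of a by q^{-2l} unless it kills the
eigenvector. Since a is bounded, the climb must stop, and it can stop only at a root of f.
`mem_spectrum_of_qcomm` runs this argument on spectral points, where no eigenvector is available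
yet. Hence the nonzero spectrum of a consists of powers q^{2m}, and if a ≠ 0 it contains some q^{2s}
with 1 ≤ s ≤ l (`spectrum_map_a`). This point is isolated, so it is an eigenvalue. A unit
eigenvector v is killed by b because f(q^{2s}) = 0, and the normalized vectors b*^p v form an
orthonormal sequence on which g dictates the weights of π_s. Their closed span is invariant, so
irreducibility makes it the whole space. If a = 0, then b = 0 and only scalars act.

For existence, the standard representation of the sphere on ℓ²(ℕ) is restricted to the span of the
e_n with n ≡ s - 1 mod l. Irreducibility holds because a has simple eigenvalues there and b* carries
e_0 to every basis direction; inequivalence is read off the eigenvalues of a. -/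

theorem qcomm_pow_right {x y : R} {c : ℂ} (h : x * y = c • (y * x)) (n : ℕ) :
    x * y ^ n = c ^ n • (y ^ n * x) := by
  induction n with
  | zero => simp
  | succ n ih =>
    rw [pow_succ, ← mul_assoc, ih, smul_mul_assoc, mul_assoc, h, mul_smul_comm, smul_smul,
      mul_assoc, pow_succ]

theorem qcomm_symm {x y : R} {c : ℂ} (hc : c ≠ 0) (h : x * y = c • (y * x)) :
    y * x = c⁻¹ • (x * y) := by
  rw [h, smul_smul, inv_mul_cancel₀ hc, one_smul]

theorem qcomm_pow_left {x y : R} {c : ℂ} (h : x * y = c • (y * x)) (n : ℕ) :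
    x ^ n * y = c ^ n • (y * x ^ n) := by
  induction n with
  | zero => simp
  | succ n ih =>
    rw [pow_succ', mul_assoc, ih, mul_smul_comm, ← mul_assoc, h, smul_mul_assoc, smul_smul,
      mul_assoc, pow_succ]

theorem qcomm_mul {x y z : R} {c d : ℂ} (hx : x * z = c • (z * x)) (hy : y * z = d • (z * y)) :
    (x * y) * z = (c * d) • (z * (x * y)) := by
  rw [mul_assoc, hy, mul_smul_comm, ← mul_assoc, hx, smul_mul_assoc, smul_smul, mul_assoc,
    mul_comm d]

end QCommute

/-! ### Spanning monomials and products of powers in the sphere algebra -/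

namespace Sphere

theorem star_real_smul (x : Sphere q) : star ((q : ℂ) • x) = (q : ℂ) • star x := by
  rw [star_smul, Complex.star_def, Complex.conj_ofReal]

theorem beta_star_alpha_star :
    star (β q) * star (α q) = (q : ℂ) • (star (α q) * star (β q)) := by
  rw [← star_mul, alpha_beta, star_real_smul, star_mul]

theorem beta_alpha_star : β q * star (α q) = (q : ℂ) • (star (α q) * β q) := by
  simpa only [star_mul, star_star, star_real_smul] using congrArg star (alpha_star_beta q)

theorem beta_alpha (hq : q ≠ 0) : β q * α q = (q : ℂ)⁻¹ • (α q * β q) :=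
  qcomm_symm (by exact_mod_cast hq) (alpha_beta q)

theorem beta_star_alpha (hq : q ≠ 0) : star (β q) * α q = (q : ℂ)⁻¹ • (α q * star (β q)) :=
  qcomm_symm (by exact_mod_cast hq) (alpha_star_beta q)

theorem alpha_mul_star : α q * star (α q) = 1 - β q * star (β q) :=
  eq_sub_of_add_eq (sphere_eq q)

theorem star_alpha_mul : star (α q) * α q = 1 - ((q : ℂ)⁻¹ ^ 2) • (β q * star (β q)) := by
  have h := alpha_star_alpha q
  rw [alpha_mul_star, sub_smul, one_smul] at h
  have h2 : (q : ℂ) ^ (-2 : ℤ) = (q : ℂ)⁻¹ ^ 2 := by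
    rw [zpow_neg, inv_pow]; norm_cast
  rw [h2] at h
  have := eq_sub_of_add_eq h.symm
  rw [this]; abel

theorem absq_alpha (hq : q ≠ 0) :
    (β q * star (β q)) * α q = ((q : ℂ)⁻¹ ^ 2) • (α q * (β q * star (β q))) := by
  rw [pow_two]
  exact qcomm_mul (beta_alpha hq) (beta_star_alpha hq)

theorem absq_alpha_star :
    (β q * star (β q)) * star (α q) = ((q : ℂ) ^ 2) • (star (α q) * (β q * star (β q))) := by
  rw [pow_two]
  exact qcomm_mul beta_alpha_star beta_star_alpha_star

theorem beta_comm : Commute (β q) (star (β q)) := beta_normal q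

/-- The monomials `α^i β^j β*^m` and `α*^i β^j β*^m`. -/
def monomial (q : ℝ) : Bool → ℕ → ℕ → ℕ → Sphere q
  | false, i, j, m => α q ^ i * (β q ^ j * star (β q) ^ m)
  | true, i, j, m => star (α q) ^ i * (β q ^ j * star (β q) ^ m)

/-- The linear span of the monomials. -/
def monomialSpan (q : ℝ) : Submodule ℂ (Sphere q) :=
  Submodule.span ℂ (Set.range fun t : Bool × ℕ × ℕ × ℕ => monomial q t.1 t.2.1 t.2.2.1 t.2.2.2)

theorem monomial_mem (c : Bool) (i j m : ℕ) : monomial q c i j m ∈ monomialSpan q :=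
  Submodule.subset_span ⟨(c, i, j, m), rfl⟩

theorem beta_mul_tail (j m : ℕ) :
    β q * (β q ^ j * star (β q) ^ m) = β q ^ (j + 1) * star (β q) ^ m := by
  rw [← mul_assoc, pow_succ']

theorem beta_star_mul_tail (j m : ℕ) :
    star (β q) * (β q ^ j * star (β q) ^ m) = β q ^ j * star (β q) ^ (m + 1) := by
  rw [← mul_assoc, (beta_comm.symm.pow_right j).eq, mul_assoc, pow_succ']

theorem absq_mul_tail (j m : ℕ) :
    (β q * star (β q)) * (β q ^ j * star (β q) ^ m) = β q ^ (j + 1) * star (β q) ^ (m + 1) := by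
  rw [mul_assoc, beta_star_mul_tail, beta_mul_tail]

theorem qcomm_mul_monomial {x y z w : Sphere q} {c : ℂ} (h : x * y = c • (y * x)) (i : ℕ)
    (hz : x * z = w) : x * (y ^ i * z) = c ^ i • (y ^ i * w) := by
  rw [← mul_assoc, qcomm_pow_right h, smul_mul_assoc, mul_assoc, hz]

/-- A letter raises one exponent up to a scalar, except when α meets α* (or conversely). Then αα* or
α*α is 1 minus a multiple of ββ*, and ββ* q-commutes past the remaining power into the tail. -/
theorem letter_mul_monomial (hq : q ≠ 0) (g : SphereGen) (d c : Bool) (i j m : ℕ) :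
    mk q (FreeStarAlgebra.letter g d) * monomial q c i j m ∈ monomialSpan q := by
  have hα : mk q (FreeStarAlgebra.letter .alpha true) = star (α q) := by
    rw [α, ← mk_star, FreeStarAlgebra.gen, FreeStarAlgebra.star_letter]; rfl
  have hβ : mk q (FreeStarAlgebra.letter .beta true) = star (β q) := by
    rw [β, ← mk_star, FreeStarAlgebra.gen, FreeStarAlgebra.star_letter]; rfl
  have hα' : mk q (FreeStarAlgebra.letter .alpha false) = α q := rfl
  have hβ' : mk q (FreeStarAlgebra.letter .beta false) = β q := rfl
  rcases g with _ | _ <;> rcases d with _ | _ <;> rcases c with _ | _ <;>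
    simp only [hα, hβ, hα', hβ']
  · convert monomial_mem (q := q) false (i + 1) j m using 1
    simp only [monomial, pow_succ', mul_assoc]
  · rcases i with _ | i
    · convert monomial_mem (q := q) false 1 j m using 1
      simp [monomial]
    · have : α q * monomial q true (i + 1) j m = monomial q true i j m
          - ((q : ℂ) ^ 2) ^ i • monomial q true i (j + 1) (m + 1) := by
        simp only [monomial]
        rw [pow_succ', mul_assoc, ← mul_assoc (α q), alpha_mul_star, sub_mul, one_mul,
          qcomm_mul_monomial absq_alpha_star i (absq_mul_tail j m)]
      rw [this]
      exact sub_mem (monomial_mem _ _ _ _) (Submodule.smul_mem _ _ (monomial_mem _ _ _ _))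
  · rcases i with _ | i
    · convert monomial_mem (q := q) true 1 j m using 1
      simp [monomial]
    · have : star (α q) * monomial q false (i + 1) j m = monomial q false i j m
          - ((q : ℂ)⁻¹ ^ 2) • ((q : ℂ)⁻¹ ^ 2) ^ i • monomial q false i (j + 1) (m + 1) := by
        simp only [monomial]
        rw [pow_succ', mul_assoc, ← mul_assoc (star (α q)), star_alpha_mul, sub_mul, one_mul,
          smul_mul_assoc, qcomm_mul_monomial (absq_alpha hq) i (absq_mul_tail j m)]
      rw [this]
      exact sub_mem (monomial_mem _ _ _ _)
        (Submodule.smul_mem _ _ (Submodule.smul_mem _ _ (monomial_mem _ _ _ _)))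
  · convert monomial_mem (q := q) true (i + 1) j m using 1
    simp only [monomial, pow_succ', mul_assoc]
  · simp only [monomial]
    rw [qcomm_mul_monomial (beta_alpha hq) i (beta_mul_tail j m)]
    exact Submodule.smul_mem _ _ (monomial_mem false _ _ _)
  · simp only [monomial]
    rw [qcomm_mul_monomial beta_alpha_star i (beta_mul_tail j m)]
    exact Submodule.smul_mem _ _ (monomial_mem true _ _ _)
  · simp only [monomial]
    rw [qcomm_mul_monomial (beta_star_alpha hq) i (beta_star_mul_tail j m)]
    exact Submodule.smul_mem _ _ (monomial_mem false _ _ _)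
  · simp only [monomial]
    rw [qcomm_mul_monomial beta_star_alpha_star i (beta_star_mul_tail j m)]
    exact Submodule.smul_mem _ _ (monomial_mem true _ _ _)

theorem mk_mul_mem (hq : q ≠ 0) (w : FreeStarAlgebra SphereGen) :
    ∀ x ∈ monomialSpan q, mk q w * x ∈ monomialSpan q := by
  refine FreeStarAlgebra.induction
    (P := fun w => ∀ x ∈ monomialSpan q, mk q w * x ∈ monomialSpan q) ?_ ?_ ?_ ?_ w
  · intro c x hx
    rw [AlgHomClass.commutes, ← Algebra.smul_def]
    exact Submodule.smul_mem _ _ hx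
  · intro g d x hx
    induction hx using Submodule.span_induction with
    | mem x h => obtain ⟨t, rfl⟩ := h; exact letter_mul_monomial hq _ _ _ _ _ _
    | zero => rw [mul_zero]; exact zero_mem _
    | add x y _ _ hx hy => rw [mul_add]; exact add_mem hx hy
    | smul c x _ hx => rw [mul_smul_comm]; exact Submodule.smul_mem _ _ hx
  · intro v w hv hw x hx
    rw [map_mul, mul_assoc]
    exact hv _ (hw _ hx)
  · intro v w hv hw x hx
    rw [map_add, add_mul]
    exact add_mem (hv _ hx) (hw _ hx)

/-- The span is stable under left multiplication and contains 1, the monomial with all exponents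
zero. Linear independence is never needed. -/
theorem mem_monomialSpan (hq : q ≠ 0) (x : Sphere q) : x ∈ monomialSpan q := by
  obtain ⟨w, rfl⟩ := mk_surjective q x
  have h := mk_mul_mem hq w (monomial q false 0 0 0) (monomial_mem _ _ _ _)
  simpa [monomial] using h

theorem absq_alpha_pow (hq : q ≠ 0) (n : ℕ) :
    (β q * star (β q)) * α q ^ n = ((q : ℂ)⁻¹ ^ 2) ^ n • (α q ^ n * (β q * star (β q))) :=
  qcomm_pow_right (absq_alpha hq) n

theorem absq_alpha_star_pow (n : ℕ) :
    (β q * star (β q)) * star (α q) ^ n =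
      ((q : ℂ) ^ 2) ^ n • (star (α q) ^ n * (β q * star (β q))) :=
  qcomm_pow_right absq_alpha_star n

/-- The innermost pair is α*α = 1 - q^{-2}ββ*; pulling ββ* out through α^n costs q^{-2n}, which
produces the factor r = n. -/
theorem star_alpha_pow_mul (hq : q ≠ 0) (n : ℕ) :
    star (α q) ^ n * α q ^ n = aeval (β q * star (β q))
      (∏ r ∈ Finset.range n, (1 - C (((q : ℂ)⁻¹ ^ 2) ^ (r + 1)) * X)) := by
  induction n with
  | zero => simp
  | succ n ih =>
    rw [Finset.prod_range_succ, map_mul, ← ih]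
    rw [pow_succ, pow_succ' (α q), mul_assoc, ← mul_assoc (star (α q)), star_alpha_mul, sub_mul,
      one_mul, smul_mul_assoc, absq_alpha_pow hq, mul_sub, mul_smul_comm, mul_smul_comm, smul_smul,
      ← pow_succ']
    simp only [map_sub, map_one, map_mul, aeval_X, aeval_C, ← Algebra.smul_def, mul_sub, mul_one,
      mul_smul_comm, mul_assoc]

/-- Here the innermost pair is αα* = 1 - ββ*, so the exponents start at 0 instead of 1. -/
theorem alpha_pow_mul_star (n : ℕ) :
    α q ^ n * star (α q) ^ n = aeval (β q * star (β q))
      (∏ r ∈ Finset.range n, (1 - C (((q : ℂ) ^ 2) ^ r) * X)) := by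
  induction n with
  | zero => simp
  | succ n ih =>
    rw [Finset.prod_range_succ, map_mul, ← ih]
    rw [pow_succ, pow_succ' (star (α q)), mul_assoc, ← mul_assoc (α q), alpha_mul_star, sub_mul,
      one_mul, absq_alpha_star_pow, mul_sub, mul_smul_comm]
    simp only [map_sub, map_one, map_mul, aeval_X, aeval_C, ← Algebra.smul_def, mul_sub, mul_one,
      mul_smul_comm, mul_assoc]

theorem beta_commute_absq : Commute (β q) (β q * star (β q)) :=
  (Commute.refl _).mul_right beta_comm

end Sphere

/-! ### The coinvariants are generated by a and b -/

/-- The projection of `O(S³_q) ⊗ ℂ[u, u*]` onto the coefficient of `u^0`. -/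
def zeroCoeff (q : ℝ) : Sphere q ⊗[ℂ] ℂ[T;T⁻¹] →ₗ[ℂ] Sphere q :=
  (TensorProduct.rid ℂ (Sphere q)).toLinearMap ∘ₗ
    (Finsupp.lapply (0 : ℤ) ∘ₗ (AddMonoidAlgebra.coeffLinearEquiv ℂ).toLinearMap).lTensor (Sphere q)

theorem zeroCoeff_tmul_T (x : Sphere q) (n : ℤ) :
    zeroCoeff q (x ⊗ₜ LaurentPolynomial.T n) = if n = 0 then x else 0 := by
  have : ((AddMonoidAlgebra.coeffLinearEquiv ℂ) (LaurentPolynomial.T n : ℂ[T;T⁻¹])) 0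
      = if n = 0 then 1 else 0 := LaurentPolynomial.T_apply 0 n
  simp only [zeroCoeff, LinearMap.comp_apply, LinearMap.lTensor_tmul, LinearEquiv.coe_coe,
    Finsupp.lapply_apply, TensorProduct.rid_tmul, this]
  split_ifs <;> simp

theorem coaction_alpha_pow (i : ℕ) : coaction q k l (Sphere.α q ^ i) =
    (Sphere.α q ^ i) ⊗ₜ LaurentPolynomial.T (i * k : ℤ) := by
  simp only [coaction, map_pow, Sphere.lift_α, Algebra.TensorProduct.tmul_pow,
    LaurentPolynomial.T_pow]

theorem coaction_beta_pow (i : ℕ) : coaction q k l (Sphere.β q ^ i) =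
    (Sphere.β q ^ i) ⊗ₜ LaurentPolynomial.T (-(i * l) : ℤ) := by
  simp only [coaction, map_pow, Sphere.lift_β, Algebra.TensorProduct.tmul_pow,
    LaurentPolynomial.T_pow, mul_neg]

theorem coaction_monomial_false (i j m : ℕ) : coaction q k l (Sphere.monomial q false i j m) =
    Sphere.monomial q false i j m ⊗ₜ LaurentPolynomial.T (i * k - j * l + m * l : ℤ) := by
  simp only [Sphere.monomial, map_mul, ← star_pow, map_star, coaction_alpha_pow, coaction_beta_pow,
    TensorProduct.star_tmul, star_T, Algebra.TensorProduct.tmul_mul_tmul,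
    ← LaurentPolynomial.T_add, neg_neg]
  congr 2; ring

theorem coaction_monomial_true (i j m : ℕ) : coaction q k l (Sphere.monomial q true i j m) =
    Sphere.monomial q true i j m ⊗ₜ LaurentPolynomial.T (-(i * k) - j * l + m * l : ℤ) := by
  simp only [Sphere.monomial, map_mul, ← star_pow, map_star, coaction_alpha_pow, coaction_beta_pow,
    TensorProduct.star_tmul, star_T, Algebra.TensorProduct.tmul_mul_tmul,
    ← LaurentPolynomial.T_add, neg_neg]
  congr 2; ring

/-- The `*`-subalgebra of `O(S³_q)` generated by `a` and `b`. -/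
def generated (q : ℝ) (k l : ℕ) : StarSubalgebra ℂ (Sphere q) :=
  StarAlgebra.adjoin ℂ {(a q k l : Sphere q), (b q k l : Sphere q)}

theorem absq_mem : Sphere.β q * star (Sphere.β q) ∈ generated q k l :=
  StarAlgebra.subset_adjoin ℂ _ (Or.inl rfl)

theorem b_mem : Sphere.α q ^ l * Sphere.β q ^ k ∈ generated q k l :=
  StarAlgebra.subset_adjoin ℂ _ (Or.inr rfl)

theorem alpha_pow_mul_beta_pow_mem (t : ℕ) :
    Sphere.α q ^ (l * t) * Sphere.β q ^ (k * t) ∈ generated q k l := by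
  induction t with
  | zero => simp
  | succ t ih =>
    have h := qcomm_pow_right (qcomm_pow_left (Sphere.alpha_beta q) (l * t)) k
    have : Sphere.α q ^ (l * (t + 1)) * Sphere.β q ^ (k * (t + 1)) =
        ((q : ℂ) ^ (l * t)) ^ k • ((Sphere.α q ^ l * Sphere.β q ^ k) *
          (Sphere.α q ^ (l * t) * Sphere.β q ^ (k * t))) := by
      rw [mul_add, mul_add, mul_one, mul_one, add_comm, add_comm (k * t), pow_add, pow_add,
        mul_assoc, ← mul_assoc (Sphere.α q ^ (l * t)), h]
      simp only [mul_smul_comm, smul_mul_assoc, mul_assoc]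
    rw [this]
    exact SMulMemClass.smul_mem _ (mul_mem b_mem ih)

/-- Together with `monomial_true_mem` this covers all monomials of weight zero: coprimality forces
the exponent of α or α* to be a multiple lt of l, and then the exponents of β and β* differ by kt.
-/
theorem monomial_false_mem (t m : ℕ) :
    Sphere.monomial q false (l * t) (k * t + m) m ∈ generated q k l := by
  have : Sphere.monomial q false (l * t) (k * t + m) m =
      (Sphere.α q ^ (l * t) * Sphere.β q ^ (k * t)) * (Sphere.β q * star (Sphere.β q)) ^ m := by
    rw [Sphere.beta_comm.mul_pow, Sphere.monomial, pow_add]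
    simp only [mul_assoc]
  rw [this]
  exact mul_mem (alpha_pow_mul_beta_pow_mem t) (pow_mem absq_mem m)

theorem monomial_true_mem (hq : q ≠ 0) (t j : ℕ) :
    Sphere.monomial q true (l * t) j (k * t + j) ∈ generated q k l := by
  have h := qcomm_pow_right (qcomm_pow_left (Sphere.beta_star_alpha_star (q := q)) (k * t)) (l * t)
  have h' := qcomm_symm (by simp [hq]) h
  have : Sphere.monomial q true (l * t) j (k * t + j) =
      (((q : ℂ) ^ (k * t)) ^ (l * t))⁻¹ • (star (Sphere.α q ^ (l * t) * Sphere.β q ^ (k * t)) *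
        (Sphere.β q * star (Sphere.β q)) ^ j) := by
    rw [star_mul, star_pow, star_pow, ← smul_mul_assoc, ← h', Sphere.beta_comm.mul_pow,
      Sphere.monomial, pow_add]
    simp only [mul_assoc]
    rw [← mul_assoc (Sphere.β q ^ j), (Sphere.beta_comm.pow_pow j (k * t)).eq]
    simp only [mul_assoc]
  rw [this]
  exact SMulMemClass.smul_mem _ (mul_mem (star_mem (alpha_pow_mul_beta_pow_mem t))
    (pow_mem absq_mem j))

/-- The composite fixes a monomial of weight zero and kills every other one, so checking it on the
spanning set suffices. -/
theorem zeroCoeff_coaction_mem (hq : q ≠ 0) (hl : 0 < l) (hkl : Nat.Coprime k l) (x : Sphere q) :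
    zeroCoeff q (coaction q k l x) ∈ generated q k l := by
  -- This is vanishing of the weight, stated for unstarred monomials; for starred ones it is applied
  -- with the roles of j and m exchanged.
  have arith : ∀ i j m : ℕ, i * k + m * l = j * l → ∃ t, i = l * t ∧ j = k * t + m := by
    intro i j m h
    have h1 : l ∣ i * k := (Nat.dvd_add_left (Dvd.intro_left m rfl)).1 (h ▸ Dvd.intro_left j rfl)
    obtain ⟨t, rfl⟩ := hkl.symm.dvd_of_dvd_mul_right h1
    refine ⟨t, rfl, Nat.eq_of_mul_eq_mul_right hl ?_⟩
    rw [← h]; ring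
  have hx := Sphere.mem_monomialSpan hq x
  induction hx using Submodule.span_induction with
  | mem x h =>
    obtain ⟨⟨c, i, j, m⟩, rfl⟩ := h
    cases c
    · dsimp only
      rw [coaction_monomial_false, zeroCoeff_tmul_T]
      split_ifs with h
      · obtain ⟨t, rfl, rfl⟩ := arith i j m (by zify; linarith)
        exact monomial_false_mem t m
      · exact zero_mem _
    · dsimp only
      rw [coaction_monomial_true, zeroCoeff_tmul_T]
      split_ifs with h
      · obtain ⟨t, rfl, rfl⟩ := arith i m j (by zify; linarith)
        exact monomial_true_mem hq t j
      · exact zero_mem _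
  | zero => simp
  | add x y _ _ hx hy => rw [map_add, map_add]; exact add_mem hx hy
  | smul c x _ hx => rw [map_smul, map_smul]; exact SMulMemClass.smul_mem _ hx

theorem WP_le_generated (hq : q ≠ 0) (hl : 0 < l) (hkl : Nat.Coprime k l) {x : Sphere q}
    (hx : x ∈ WP q k l) : x ∈ generated q k l := by
  have h : coaction q k l x = x ⊗ₜ[ℂ] (1 : ℂ[T;T⁻¹]) := hx
  have h2 := zeroCoeff_coaction_mem hq hl hkl x
  rw [h, ← LaurentPolynomial.T_zero, zeroCoeff_tmul_T, if_pos rfl] at h2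
  exact h2

/-- `O(WP_q(k,l))` is generated by `a` and `b` as a `*`-algebra. -/
theorem WP_induction (hq : q ≠ 0) (hl : 0 < l) (hkl : Nat.Coprime k l) {P : WP q k l → Prop}
    (ha : P (a q k l)) (hb : P (b q k l)) (hc : ∀ c : ℂ, P (algebraMap ℂ _ c))
    (hadd : ∀ x y, P x → P y → P (x + y)) (hmul : ∀ x y, P x → P y → P (x * y))
    (hstar : ∀ x, P x → P (star x)) (x : WP q k l) : P x := by
  obtain ⟨x, hx⟩ := x
  have key : ∃ hx : x ∈ WP q k l, P ⟨x, hx⟩ := by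
    refine StarAlgebra.adjoin_induction (p := fun x _ => ∃ hx : x ∈ WP q k l, P ⟨x, hx⟩)
      ?_ ?_ ?_ ?_ ?_ (WP_le_generated hq hl hkl hx)
    · rintro x (rfl | rfl)
      · exact ⟨_, ha⟩
      · exact ⟨_, hb⟩
    · exact fun c => ⟨_, hc c⟩
    · rintro x y - - ⟨hx, hPx⟩ ⟨hy, hPy⟩
      exact ⟨_, hadd _ _ hPx hPy⟩
    · rintro x y - - ⟨hx, hPx⟩ ⟨hy, hPy⟩
      exact ⟨_, hmul _ _ hPx hPy⟩
    · rintro x - ⟨hx, hPx⟩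
      exact ⟨_, hstar _ hPx⟩
  exact key.2

theorem WP_hom_ext (hq : q ≠ 0) (hl : 0 < l) (hkl : Nat.Coprime k l)
    {B : Type*} [Ring B] [StarRing B] [Algebra ℂ B] {ρ ρ' : WP q k l →⋆ₐ[ℂ] B}
    (ha : ρ (a q k l) = ρ' (a q k l)) (hb : ρ (b q k l) = ρ' (b q k l)) : ρ = ρ' := by
  refine StarAlgHom.ext (WP_induction hq hl hkl ha hb ?_ ?_ ?_ ?_)
  · intro c; rw [AlgHomClass.commutes, AlgHomClass.commutes]
  · intro x y hx hy; rw [map_add, map_add, hx, hy]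
  · intro x y hx hy; rw [map_mul, map_mul, hx, hy]
  · intro x hx; rw [map_star, map_star, hx]

/-! ### Relations between `a` and `b` -/

/-- The polynomial `f` with `b* b = f(a)`. -/
def starMulPoly (q : ℝ) (k l : ℕ) : ℂ[X] :=
  (∏ r ∈ Finset.range l, (1 - C (((q : ℂ)⁻¹ ^ 2) ^ (r + 1)) * X)) * X ^ k

/-- The polynomial `g` with `b b* = g(a)`. -/
def mulStarPoly (q : ℝ) (k l : ℕ) : ℂ[X] :=
  C ((((q : ℂ) ^ 2) ^ l) ^ k) * ((∏ r ∈ Finset.range l, (1 - C (((q : ℂ) ^ 2) ^ r) * X)) * X ^ k)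

theorem star_a : star (a q k l) = a q k l := by
  refine Subtype.ext ?_
  change star (Sphere.β q * star (Sphere.β q)) = _
  rw [star_mul, star_star]; rfl

theorem coe_aeval_a (p : ℂ[X]) : ((aeval (a q k l) p : WP q k l) : Sphere q) =
    aeval (Sphere.β q * star (Sphere.β q)) p :=
  (Polynomial.aeval_algHom_apply (WP q k l).subtype.toAlgHom (a q k l) p).symm

/-- Between β*^k and β^k stands α*^l α^l, a polynomial in ββ*, which commutes with β*. -/
theorem star_b_mul_b (hq : q ≠ 0) :
    star (b q k l) * b q k l = aeval (a q k l) (starMulPoly q k l) := by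
  refine Subtype.ext ?_
  rw [coe_aeval_a]
  change star (Sphere.α q ^ l * Sphere.β q ^ k) * (Sphere.α q ^ l * Sphere.β q ^ k) = _
  have hc : Commute (star (Sphere.β q)) (Sphere.β q * star (Sphere.β q)) :=
    Sphere.beta_comm.symm.mul_right (Commute.refl _)
  rw [star_mul, star_pow, star_pow, mul_assoc, ← mul_assoc (star (Sphere.α q) ^ l),
    Sphere.star_alpha_pow_mul hq, starMulPoly, map_mul, ← mul_assoc]
  have hcomm : ∀ p : ℂ[X], Commute (star (Sphere.β q) ^ k)
      (aeval (Sphere.β q * star (Sphere.β q)) p) := fun p => by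
    induction p using Polynomial.induction_on' with
    | add p r hp hr => rw [map_add]; exact hp.add_right hr
    | monomial n c =>
      rw [aeval_monomial]
      exact (Algebra.commute_algebraMap_right c _).mul_right ((hc.pow_left k).pow_right n)
  rw [(hcomm _).eq, mul_assoc, map_pow, aeval_X, Sphere.beta_normal, Sphere.beta_comm.symm.mul_pow]

/-- The constant q^{2lk} comes from moving (ββ*)^k to the right past α*^l. -/
theorem b_mul_star_b : b q k l * star (b q k l) = aeval (a q k l) (mulStarPoly q k l) := by
  refine Subtype.ext ?_
  rw [coe_aeval_a]
  change (Sphere.α q ^ l * Sphere.β q ^ k) * star (Sphere.α q ^ l * Sphere.β q ^ k) = _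
  rw [star_mul, star_pow, star_pow, mul_assoc, ← mul_assoc (Sphere.β q ^ k),
    ← Sphere.beta_comm.mul_pow, qcomm_pow_left (Sphere.absq_alpha_star_pow l) k, mul_smul_comm,
    ← mul_assoc, Sphere.alpha_pow_mul_star, mulStarPoly, map_mul, map_mul, aeval_C,
    ← Algebra.smul_def, map_pow, aeval_X]

/-- Only α^l contributes a scalar, since β commutes with ββ*. Consequently b divides eigenvalues of
a by q^{2l} and b* multiplies them by q^{2l}. -/
theorem b_mul_a : b q k l * a q k l = ((q : ℂ) ^ 2) ^ l • (a q k l * b q k l) := by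
  refine Subtype.ext ?_
  have h : Sphere.α q * (Sphere.β q * star (Sphere.β q)) =
      ((q : ℂ) ^ 2) • ((Sphere.β q * star (Sphere.β q)) * Sphere.α q) := by
    rw [← mul_assoc, Sphere.alpha_beta, smul_mul_assoc, mul_assoc, Sphere.alpha_star_beta,
      mul_smul_comm, smul_smul, ← mul_assoc, pow_two]
  change (Sphere.α q ^ l * Sphere.β q ^ k) * (Sphere.β q * star (Sphere.β q)) =
    ((q : ℂ) ^ 2) ^ l • ((Sphere.β q * star (Sphere.β q)) * (Sphere.α q ^ l * Sphere.β q ^ k))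
  rw [mul_assoc, (Sphere.beta_commute_absq.pow_left k).eq, ← mul_assoc, qcomm_pow_left h,
    smul_mul_assoc, mul_assoc]

/-! ### Operators on `ℓ²(ℕ)` -/

theorem e_apply (p j : ℕ) : e p j = if j = p then 1 else 0 := by
  rw [e, lp.single_apply, Pi.single_apply]

theorem inner_e_left (p : ℕ) (x : L2) : inner ℂ (e p) x = x p := by
  rw [e, lp.inner_single_left]; simp

theorem orthonormal_e : Orthonormal ℂ e := by
  rw [orthonormal_iff_ite]
  intro i j
  rw [inner_e_left, e_apply]

theorem e_ne_zero (p : ℕ) : e p ≠ 0 := orthonormal_e.ne_zero p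

theorem mem_of_forall_e_mem {K : Submodule ℂ L2} (hK : IsClosed (K : Set L2))
    (h : ∀ p, e p ∈ K) (x : L2) : x ∈ K := by
  refine hK.mem_of_tendsto (lp.hasSum_single (by simp) x) (Filter.Eventually.of_forall fun s => ?_)
  refine sum_mem fun p _ => ?_
  have : lp.single 2 p (x p) = x p • e p := by
    rw [e, ← lp.single_smul, smul_eq_mul, mul_one]
  rw [this]
  exact K.smul_mem _ (h p)

theorem ext_e {F : Type*} [NormedAddCommGroup F] [NormedSpace ℂ F] {S T : L2 →L[ℂ] F}
    (h : ∀ p, S (e p) = T (e p)) : S = T := by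
  ext1 x
  have := mem_of_forall_e_mem (K := (S - T).ker) (S - T).isClosed_ker
    (fun p => by simp [h p]) x
  simpa [sub_eq_zero] using this

theorem ext_inner_e {x y : L2} (h : ∀ j, inner ℂ (e j) x = inner ℂ (e j) y) : x = y := by
  refine lp.ext (funext fun j => ?_)
  simpa only [inner_e_left] using h j

/-- The diagonal operator with real entries in `[-1, 1]`. -/
def diag (c : ℕ → ℝ) (hc : ∀ p, |c p| ≤ 1) : L2 →L[ℂ] L2 :=
  LinearMap.mkContinuous
    { toFun := fun x => ⟨fun p => (c p : ℂ) * x p, by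
        refine (lp.memℓp x).mono' fun p => ?_
        rw [norm_mul, Complex.norm_real]
        exact mul_le_of_le_one_left (norm_nonneg _) (hc p)⟩
      map_add' := fun x y => lp.ext (funext fun p => by
        change (c p : ℂ) * (x p + y p) = c p * x p + c p * y p
        ring)
      map_smul' := fun r x => lp.ext (funext fun p => by
        change (c p : ℂ) * (r * x p) = r * (c p * x p)
        ring) } 1 (fun x => by
      rw [one_mul]
      refine lp.norm_mono (by simp) fun p => ?_
      change ‖(c p : ℂ) * x p‖ ≤ _
      rw [norm_mul, Complex.norm_real]
      exact mul_le_of_le_one_left (norm_nonneg _) (hc p))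

theorem diag_apply (c : ℕ → ℝ) (hc : ∀ p, |c p| ≤ 1) (x : L2) (p : ℕ) :
    diag c hc x p = c p * x p := rfl

theorem diag_e (c : ℕ → ℝ) (hc : ∀ p, |c p| ≤ 1) (p : ℕ) : diag c hc (e p) = (c p : ℂ) • e p := by
  refine lp.ext (funext fun j => ?_)
  rw [diag_apply, lp.coeFn_smul, Pi.smul_apply, e_apply]
  split_ifs with h
  · rw [h]; rfl
  · simp

theorem star_diag (c : ℕ → ℝ) (hc : ∀ p, |c p| ≤ 1) : star (diag c hc) = diag c hc := by
  refine ext_e fun p => ext_inner_e fun j => ?_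
  rw [ContinuousLinearMap.star_eq_adjoint, ContinuousLinearMap.adjoint_inner_right, diag_e, diag_e,
    inner_smul_left, inner_smul_right, Complex.conj_ofReal, inner_e_left, e_apply]
  split_ifs with h
  · rw [h]
  · simp

section basisIsometry

variable {H : Type*} [NormedAddCommGroup H] [InnerProductSpace ℂ H] [CompleteSpace H]

/-- The isometry from `ℓ²(ℕ)` determined by an orthonormal sequence. -/
def basisIsometry {w : ℕ → H} (hw : Orthonormal ℂ w) : L2 →ₗᵢ[ℂ] H :=
  hw.orthogonalFamily.linearIsometry

theorem basisIsometry_e {w : ℕ → H} (hw : Orthonormal ℂ w) (p : ℕ) :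
    basisIsometry hw (e p) = w p := by
  rw [basisIsometry, e, OrthogonalFamily.linearIsometry_apply_single]
  simp

end basisIsometry

/-- The unilateral shift. -/
def shift : L2 →ₗᵢ[ℂ] L2 := basisIsometry (orthonormal_e.comp (· + 1) (add_left_injective 1))

theorem shift_e (p : ℕ) : shift (e p) = e (p + 1) := basisIsometry_e _ p

section compress

variable {A : Type*} [Ring A] [StarRing A] [Algebra ℂ A]
  {H : Type*} [NormedAddCommGroup H] [InnerProductSpace ℂ H] [CompleteSpace H]
  {H' : Type*} [NormedAddCommGroup H'] [InnerProductSpace ℂ H'] [CompleteSpace H']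

theorem adjoint_isometry_apply (J : H' →ₗᵢ[ℂ] H) (v : H') :
    ContinuousLinearMap.adjoint J.toContinuousLinearMap (J v) = v := by
  refine ext_inner_left ℂ fun w => ?_
  rw [ContinuousLinearMap.adjoint_inner_right]
  exact J.inner_map_map w v

/-- A representation that leaves the range of an isometry invariant is pulled back along it. -/
theorem exists_rep_of_invariant (ρ : BoundedRep A H) (J : H' →ₗᵢ[ℂ] H)
    (h : ∀ x v, ∃ w, ρ x (J v) = J w) :
    ∃ π : BoundedRep A H', ∀ x v, J (π x v) = ρ x (J v) := by
  set j := J.toContinuousLinearMap with hj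
  -- Compression by the isometry. Since j*j = 1, invariance of the range gives J (T x v) = ρ x (J
  -- v), and this is what makes T multiplicative.
  set T : A → (H' →L[ℂ] H') := fun x => ContinuousLinearMap.adjoint j ∘L ρ x ∘L j with hT
  have key : ∀ x v, J (T x v) = ρ x (J v) := by
    intro x v
    obtain ⟨w, hw⟩ := h x v
    have : T x v = ContinuousLinearMap.adjoint j (ρ x (J v)) := rfl
    rw [this, hw, adjoint_isometry_apply]
  have ext : ∀ {S S' : H' →L[ℂ] H'}, (∀ v, J (S v) = J (S' v)) → S = S' := fun h =>
    ContinuousLinearMap.ext fun v => J.injective (h v)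
  refine ⟨{ toFun := T
            map_one' := ext fun v => by rw [key]; simp
            map_mul' := fun x y => ext fun v => by
              rw [key, map_mul, mul_apply_eq_comp, mul_apply_eq_comp, key,
                key]
            map_zero' := ext fun v => by rw [key]; simp
            map_add' := fun x y => ext fun v => by
              rw [key, map_add, add_apply, add_apply,
                map_add, key, key]
            commutes' := fun c => ext fun v => by
              rw [key, AlgHomClass.commutes]
              simp [Algebra.algebraMap_eq_smul_one]
            map_star' := fun x => by
              change ContinuousLinearMap.adjoint j ∘L ρ (star x) ∘L j =
                ContinuousLinearMap.adjoint (ContinuousLinearMap.adjoint j ∘L ρ x ∘L j)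
              rw [map_star, ContinuousLinearMap.star_eq_adjoint, ContinuousLinearMap.adjoint_comp,
                ContinuousLinearMap.adjoint_comp, ContinuousLinearMap.adjoint_adjoint,
                ContinuousLinearMap.comp_assoc] }, key⟩

end compress

/-! ### The representation of the quantum sphere on `ℓ²(ℕ)` -/

theorem abs_pow_succ_le (hq0 : 0 < q) (hq1 : q < 1) (n : ℕ) : |q ^ (n + 1)| ≤ 1 := by
  rw [abs_of_pos (pow_pos hq0 _)]
  exact pow_le_one₀ hq0.le hq1.le

theorem abs_sqrt_le (hq0 : 0 < q) (n : ℕ) : |√(1 - q ^ (2 * n))| ≤ 1 := by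
  rw [abs_of_nonneg (Real.sqrt_nonneg _)]
  refine Real.sqrt_le_one.2 ?_
  have := pow_pos hq0 (2 * n)
  linarith

theorem sq_sqrt_one_sub (hq0 : 0 < q) (hq1 : q < 1) (n : ℕ) :
    (√(1 - q ^ (2 * n)) : ℂ) * (√(1 - q ^ (2 * n)) : ℂ) = 1 - (q : ℂ) ^ (2 * n) := by
  have h : q ^ (2 * n) ≤ 1 := pow_le_one₀ hq0.le hq1.le
  rw [← Complex.ofReal_mul, Real.mul_self_sqrt (by linarith)]
  push_cast; rfl

/-- The operator `e_n ↦ (1 - q^{2n})^{1/2} e_{n-1}`. -/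
def alphaOp (hq0 : 0 < q) : L2 →L[ℂ] L2 :=
  star shift.toContinuousLinearMap * diag (fun n => √(1 - q ^ (2 * n))) (abs_sqrt_le hq0)

/-- The operator `e_n ↦ q^{n+1} e_n`. -/
def betaOp (hq0 : 0 < q) (hq1 : q < 1) : L2 →L[ℂ] L2 :=
  diag (fun n => q ^ (n + 1)) (abs_pow_succ_le hq0 hq1)

theorem alphaOp_e_zero (hq0 : 0 < q) : alphaOp hq0 (e 0) = 0 := by
  rw [alphaOp, mul_apply_eq_comp, diag_e]
  simp

theorem alphaOp_e_succ (hq0 : 0 < q) (n : ℕ) :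
    alphaOp hq0 (e (n + 1)) = (√(1 - q ^ (2 * (n + 1))) : ℂ) • e n := by
  rw [alphaOp, mul_apply_eq_comp, diag_e, map_smul, ← shift_e,
    ContinuousLinearMap.star_eq_adjoint, adjoint_isometry_apply]

theorem star_alphaOp_e (hq0 : 0 < q) (n : ℕ) :
    star (alphaOp hq0) (e n) = (√(1 - q ^ (2 * (n + 1))) : ℂ) • e (n + 1) := by
  rw [alphaOp, star_mul, star_star, star_diag, mul_apply_eq_comp]
  change diag _ _ (shift (e n)) = _
  rw [shift_e, diag_e]

theorem betaOp_e (hq0 : 0 < q) (hq1 : q < 1) (n : ℕ) :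
    betaOp hq0 hq1 (e n) = (q : ℂ) ^ (n + 1) • e n := by
  rw [betaOp, diag_e]; push_cast; rfl

theorem star_betaOp (hq0 : 0 < q) (hq1 : q < 1) : star (betaOp hq0 hq1) = betaOp hq0 hq1 :=
  star_diag _ _

theorem alphaOp_betaOp (hq0 : 0 < q) (hq1 : q < 1) :
    alphaOp hq0 * betaOp hq0 hq1 = (q : ℂ) • (betaOp hq0 hq1 * alphaOp hq0) := by
  refine ext_e fun n => ?_
  rw [mul_apply_eq_comp, smul_apply, mul_apply_eq_comp,
    betaOp_e, map_smul]
  rcases n with _ | n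
  · simp [alphaOp_e_zero, -Complex.coe_smul]
  · rw [alphaOp_e_succ, map_smul, betaOp_e, smul_smul, smul_smul, smul_smul]
    congr 1; ring

theorem alphaOp_mul_star_e (hq0 : 0 < q) (hq1 : q < 1) (n : ℕ) :
    (alphaOp hq0 * star (alphaOp hq0)) (e n) = (1 - (q : ℂ) ^ (2 * (n + 1))) • e n := by
  rw [mul_apply_eq_comp, star_alphaOp_e, map_smul, alphaOp_e_succ, smul_smul,
    sq_sqrt_one_sub hq0 hq1]

theorem star_alphaOp_mul_e (hq0 : 0 < q) (hq1 : q < 1) (n : ℕ) :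
    (star (alphaOp hq0) * alphaOp hq0) (e n) = (1 - (q : ℂ) ^ (2 * n)) • e n := by
  rw [mul_apply_eq_comp]
  rcases n with _ | n
  · simp [alphaOp_e_zero]
  · rw [alphaOp_e_succ, map_smul, star_alphaOp_e, smul_smul, sq_sqrt_one_sub hq0 hq1]

theorem betaOp_mul_self_e (hq0 : 0 < q) (hq1 : q < 1) (n : ℕ) :
    (betaOp hq0 hq1 * betaOp hq0 hq1) (e n) = (q : ℂ) ^ (2 * (n + 1)) • e n := by
  rw [mul_apply_eq_comp, betaOp_e, map_smul, betaOp_e, smul_smul, ← pow_add, two_mul]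

/-- The representation of `O(S³_q)` on `ℓ²(ℕ)`. -/
def sphereRep (hq0 : 0 < q) (hq1 : q < 1) : BoundedRep (Sphere q) L2 :=
  Sphere.lift q (alphaOp hq0) (betaOp hq0 hq1) (alphaOp_betaOp hq0 hq1)
    (by rw [star_betaOp, alphaOp_betaOp]) (by rw [star_betaOp])
    (by
      refine ext_e fun n => ?_
      rw [star_betaOp, add_apply, smul_apply,
        alphaOp_mul_star_e hq0 hq1, star_alphaOp_mul_e hq0 hq1, betaOp_mul_self_e, smul_smul,
        ← add_smul]
      congr 1
      have : (q : ℂ) ≠ 0 := by exact_mod_cast hq0.ne'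
      rw [zpow_neg, mul_add, pow_add]
      field_simp
      norm_cast
      ring)
    (by
      refine ext_e fun n => ?_
      rw [star_betaOp, add_apply, alphaOp_mul_star_e hq0 hq1,
        betaOp_mul_self_e, ← add_smul, sub_add_cancel, one_smul]
      rfl)

theorem alphaOp_pow_e (hq0 : 0 < q) (j n : ℕ) (hj : j ≤ n) :
    (alphaOp hq0 ^ j) (e n) =
      ((∏ r ∈ Finset.Icc 1 j, √(1 - q ^ (2 * ((n : ℤ) + 1 - r))) : ℝ) : ℂ) • e (n - j) := by
  induction j with
  | zero => simp
  | succ j ih =>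
    rw [pow_succ', mul_apply_eq_comp, ih (by omega), map_smul,
      Finset.prod_Icc_succ_top (by omega)]
    obtain ⟨d, rfl⟩ := Nat.exists_eq_add_of_le hj
    rw [show j + 1 + d - j = d + 1 by omega, show j + 1 + d - (j + 1) = d by omega, alphaOp_e_succ,
      smul_smul, ← Complex.ofReal_mul]
    congr 5
    rw [← zpow_natCast]
    congr 2
    push_cast; ring

theorem alphaOp_pow_e_eq_zero (hq0 : 0 < q) (j n : ℕ) (hj : n < j) :
    (alphaOp hq0 ^ j) (e n) = 0 := by
  obtain ⟨d, rfl⟩ := Nat.exists_eq_add_of_lt hj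
  rw [show n + d + 1 = d + 1 + n by ring, pow_add, mul_apply_eq_comp,
    alphaOp_pow_e hq0 n n le_rfl, map_smul, Nat.sub_self, pow_succ, mul_apply_eq_comp,
    alphaOp_e_zero, map_zero, smul_zero]

theorem star_alphaOp_pow_e (hq0 : 0 < q) (j n : ℕ) :
    ∃ c : ℂ, (star (alphaOp hq0) ^ j) (e n) = c • e (n + j) := by
  induction j with
  | zero => exact ⟨1, by simp⟩
  | succ j ih =>
    obtain ⟨c, hc⟩ := ih
    rw [pow_succ', mul_apply_eq_comp, hc, map_smul, star_alphaOp_e, smul_smul]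
    exact ⟨_, rfl⟩

theorem betaOp_pow_e (hq0 : 0 < q) (hq1 : q < 1) (j n : ℕ) :
    (betaOp hq0 hq1 ^ j) (e n) = ((q : ℂ) ^ (n + 1)) ^ j • e n := by
  induction j with
  | zero => simp
  | succ j ih =>
    rw [pow_succ', mul_apply_eq_comp, ih, map_smul, betaOp_e, smul_smul, pow_succ _ j]

/-! ### Weights and the defining polynomials -/

/-- For r ≤ l the exponent is at least 2s > 0, so every radicand is positive. The shift to p + 1
matters: at index 0 the factor r = s vanishes when s ≤ l. -/
theorem weight_succ_pos (hq0 : 0 < q) (hq1 : q < 1) (hs : 1 ≤ s) (p : ℕ) :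
    0 < weight q k l s (p + 1) := by
  refine mul_pos (pow_pos hq0 _) (Finset.prod_pos fun r hr => Real.sqrt_pos.2 ?_)
  have hr := (Finset.mem_Icc.1 hr).2
  obtain ⟨d, rfl⟩ := Nat.exists_eq_add_of_le hr
  have : (2 * (((r + d : ℕ) : ℤ) * ((p + 1 : ℕ) : ℤ) + s - r)) =
      ((2 * ((r + d) * p + d + s) : ℕ) : ℤ) := by push_cast; ring
  rw [this, zpow_natCast, sub_pos]
  exact pow_lt_one₀ hq0.le hq1 (by omega)

/-- This is the eigenvalue of bb* at level p. The two products run in opposite orders, factor 1 + r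
of the weight matching factor l - 1 - r of the polynomial. -/
theorem eval_mulStarPoly (hq0 : 0 < q) (hq1 : q < 1) (p : ℕ) :
    (mulStarPoly q k l).eval ((q ^ (2 * (l * p + s)) : ℝ) : ℂ) =
      (weight q k l s (p + 1) : ℂ) * weight q k l s (p + 1) := by
  have h1 : ∀ r ∈ Finset.range l,
      √(1 - q ^ (2 * ((l : ℤ) * ((p + 1 : ℕ) : ℤ) + s - ((1 + r : ℕ) : ℤ))))
      * √(1 - q ^ (2 * ((l : ℤ) * ((p + 1 : ℕ) : ℤ) + s - ((1 + r : ℕ) : ℤ)))) =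
        1 - (q ^ 2) ^ (l - 1 - r) * q ^ (2 * (l * p + s)) := by
    intro r hr
    obtain ⟨d, rfl⟩ := Nat.exists_eq_add_of_lt (Finset.mem_range.1 hr)
    have : (2 * (((r + d + 1 : ℕ) : ℤ) * ((p + 1 : ℕ) : ℤ) + s - ((1 + r : ℕ) : ℤ))) =
      ((2 * ((r + d + 1) * p + s + d) : ℕ) : ℤ) := by push_cast; ring
    have h : q ^ (2 * ((r + d + 1) * p + s + d)) ≤ 1 := pow_le_one₀ hq0.le hq1.le
    rw [this, zpow_natCast, Real.mul_self_sqrt (by linarith),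
      show r + d + 1 - 1 - r = d by omega, ← pow_mul, ← pow_add]
    congr 2; ring
  have h2 : weight q k l s (p + 1) * weight q k l s (p + 1) =
      ((q ^ 2) ^ l) ^ k * ((∏ r ∈ Finset.range l, (1 - (q ^ 2) ^ r * q ^ (2 * (l * p + s)))) *
        (q ^ (2 * (l * p + s))) ^ k) := by
    rw [weight, mul_mul_mul_comm, ← Finset.prod_mul_distrib, ← Finset.Ico_add_one_right_eq_Icc,
      Finset.prod_Ico_eq_prod_range, Nat.add_sub_cancel, Finset.prod_congr rfl h1,
      Finset.prod_range_reflect (fun r => 1 - (q ^ 2) ^ r * q ^ (2 * (l * p + s)))]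
    ring
  rw [← Complex.ofReal_mul, h2, mulStarPoly]
  simp [eval_prod]

theorem eval_starMulPoly_eq_zero (hq0 : 0 < q) (hs1 : 1 ≤ s) (hsl : s ≤ l) :
    (starMulPoly q k l).eval ((q ^ (2 * s) : ℝ) : ℂ) = 0 := by
  have : (q : ℂ) ≠ 0 := by exact_mod_cast hq0.ne'
  rw [starMulPoly, eval_mul, eval_prod, Finset.prod_eq_zero (Finset.mem_range.2 (show s - 1 < l by omega)),
    zero_mul]
  simp only [eval_sub, eval_one, eval_mul, eval_C, eval_X]
  rw [Nat.sub_add_cancel hs1, Complex.ofReal_pow, pow_mul, ← mul_pow, ← mul_pow, inv_mul_cancel₀ this]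
  simp

/-- The factor X^k contributes only the root 0, and factor r has the single root q^{2(r+1)}. So
climbing by b can end only at these l values. -/
theorem eq_of_eval_starMulPoly_eq_zero (hq0 : 0 < q) {t : ℂ} (ht : t ≠ 0)
    (h : (starMulPoly q k l).eval t = 0) :
    ∃ s ∈ Finset.Icc 1 l, t = ((q ^ (2 * s) : ℝ) : ℂ) := by
  have hq : (q : ℂ) ≠ 0 := by exact_mod_cast hq0.ne'
  rw [starMulPoly, eval_mul, eval_prod, mul_eq_zero, Finset.prod_eq_zero_iff] at h
  rcases h with ⟨r, hr, h⟩ | h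
  · refine ⟨r + 1, Finset.mem_Icc.2 ⟨by omega, Finset.mem_range.1 hr⟩, ?_⟩
    simp only [eval_sub, eval_one, eval_mul, eval_C, eval_X] at h
    have h := sub_eq_zero.1 h
    rw [inv_pow, inv_pow] at h
    have := (eq_inv_mul_iff_mul_eq₀ (pow_ne_zero (r + 1) (pow_ne_zero 2 hq))).1 h
    rw [← this, mul_one, Complex.ofReal_pow, pow_mul]
  · simp [ht] at h

/-! ### Representations given by the formulas -/

/-- The range of an isometry from a complete space is closed, so the vectors sent into it form a
closed subspace, which contains the basis. -/
theorem map_mem_range_of_basis {H : Type*} [NormedAddCommGroup H] [InnerProductSpace ℂ H]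
    (T : H →L[ℂ] H) (V : L2 →ₗᵢ[ℂ] H)
    (h : ∀ p, ∃ w, T (V (e p)) = V w) (v : L2) : ∃ w, T (V v) = V w := by
  let K : Submodule ℂ L2 := (LinearMap.range V.toLinearMap).comap (T ∘L V.toContinuousLinearMap).toLinearMap
  have hK : IsClosed (K : Set L2) := by
    have : IsClosed (Set.range V) := V.isometry.isClosedEmbedding.isClosed_range
    exact this.preimage (T ∘L V.toContinuousLinearMap).continuous
  obtain ⟨w, hw⟩ := mem_of_forall_e_mem hK (fun p => by
    obtain ⟨w, hw⟩ := h p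
    exact ⟨w, hw.symm⟩) v
  exact ⟨w, hw.symm⟩

section basis

variable {H : Type*} [NormedAddCommGroup H] [InnerProductSpace ℂ H] [CompleteSpace H]

/-- If an orthonormal sequence in a representation transforms by the formulas of `π_s`, then its
closed span carries the representation `π_s`. -/
theorem exists_isTeardropRep (hq0 : 0 < q) (hl : 0 < l) (hkl : Nat.Coprime k l)
    (ρ : BoundedRep (WP q k l) H) (V : L2 →ₗᵢ[ℂ] H)
    (ha : ∀ p, ρ (a q k l) (V (e p)) = ((q ^ (2 * (l * p + s)) : ℝ) : ℂ) • V (e p))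
    (hb : ∀ p, ρ (b q k l) (V (e (p + 1))) = (weight q k l s (p + 1) : ℂ) • V (e p))
    (hb0 : ρ (b q k l) (V (e 0)) = 0)
    (hb' : ∀ p, ∃ w, ρ (star (b q k l)) (V (e p)) = V w) :
    ∃ π : BoundedRep (WP q k l) L2, IsTeardropRep q k l s π ∧ ∀ x v, V (π x v) = ρ x (V v) := by
  -- Invariance is carried for x and its adjoint together, so that the star case of the induction is
  -- a swap.
  have hinv : ∀ x : WP q k l, (∀ v, ∃ w, ρ x (V v) = V w) ∧ ∀ v, ∃ w, ρ (star x) (V v) = V w := by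
    have hA : ∀ v, ∃ w, ρ (a q k l) (V v) = V w := map_mem_range_of_basis _ V fun p =>
      ⟨_, (ha p).trans (map_smul V _ _).symm⟩
    have hB : ∀ v, ∃ w, ρ (b q k l) (V v) = V w := map_mem_range_of_basis _ V fun p => by
      rcases p with _ | p
      · exact ⟨0, by rw [hb0, map_zero]⟩
      · exact ⟨_, (hb p).trans (map_smul V _ _).symm⟩
    have hc : ∀ (c : ℂ) v, ∃ w, ρ (algebraMap ℂ _ c) (V v) = V w := fun c v => by
      refine ⟨c • v, ?_⟩
      rw [AlgHomClass.commutes, Algebra.algebraMap_eq_smul_one, smul_apply, map_smul]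
      rfl
    have hadd : ∀ x y : WP q k l, (∀ v, ∃ w, ρ x (V v) = V w) → (∀ v, ∃ w, ρ y (V v) = V w) →
        ∀ v, ∃ w, ρ (x + y) (V v) = V w := fun x y hx hy v => by
      obtain ⟨w, hw⟩ := hx v
      obtain ⟨w', hw'⟩ := hy v
      exact ⟨w + w', by rw [map_add, add_apply, hw, hw', map_add]⟩
    have hmul : ∀ x y : WP q k l, (∀ v, ∃ w, ρ x (V v) = V w) → (∀ v, ∃ w, ρ y (V v) = V w) →
        ∀ v, ∃ w, ρ (x * y) (V v) = V w := fun x y hx hy v => by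
      obtain ⟨w, hw⟩ := hy v
      obtain ⟨w', hw'⟩ := hx w
      exact ⟨w', by rw [map_mul, mul_apply_eq_comp, hw, hw']⟩
    refine WP_induction hq0.ne' hl hkl ⟨hA, by rwa [star_a]⟩
      ⟨hB, map_mem_range_of_basis _ V hb'⟩ ?_ ?_ ?_ ?_
    · exact fun c => ⟨hc c, by rw [← algebraMap_star_comm]; exact hc _⟩
    · exact fun x y hx hy => ⟨hadd _ _ hx.1 hy.1, by rw [star_add]; exact hadd _ _ hx.2 hy.2⟩
    · exact fun x y hx hy => ⟨hmul _ _ hx.1 hy.1, by rw [star_mul]; exact hmul _ _ hy.2 hx.2⟩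
    · exact fun x hx => ⟨hx.2, by rw [star_star]; exact hx.1⟩
  obtain ⟨π, hπ⟩ := exists_rep_of_invariant ρ V fun x => (hinv x).1
  refine ⟨π, ⟨fun p => V.injective ?_, fun p hp => V.injective ?_, V.injective ?_⟩, hπ⟩
  · rw [hπ, ha, map_smul]
  · obtain ⟨p, rfl⟩ := Nat.exists_eq_add_of_le' hp
    rw [hπ, hb, map_smul, Nat.add_sub_cancel]
  · rw [hπ, hb0, map_zero]

end basis

theorem isTeardropRep_unique (hq0 : 0 < q) (hl : 0 < l) (hkl : Nat.Coprime k l)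
    {π π' : BoundedRep (WP q k l) L2} (h : IsTeardropRep q k l s π) (h' : IsTeardropRep q k l s π') :
    π = π' := by
  refine WP_hom_ext hq0.ne' hl hkl (ext_e fun p => by rw [h.1, h'.1]) (ext_e fun p => ?_)
  rcases p with _ | p
  · rw [h.2.2, h'.2.2]
  · rw [h.2.1 _ (by omega), h'.2.1 _ (by omega)]

theorem exists_teardropRep (hq0 : 0 < q) (hq1 : q < 1) (hl : 0 < l) (hkl : Nat.Coprime k l)
    (hs1 : 1 ≤ s) (hsl : s ≤ l) : ∃ π : BoundedRep (WP q k l) L2, IsTeardropRep q k l s π := by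
  -- On the sphere representation ββ* e_n = q^{2(n+1)} e_n, and α^l lowers n by l. The residue class
  -- of s - 1 modulo l is therefore invariant and gives the eigenvalues q^{2(lp+s)}.
  have hinj : Function.Injective fun p => l * p + (s - 1) := fun p p' h =>
    Nat.eq_of_mul_eq_mul_left hl (Nat.add_right_cancel h)
  have hV := basisIsometry_e (orthonormal_e.comp _ hinj)
  set V := basisIsometry (orthonormal_e.comp _ hinj)
  let ρ : BoundedRep (WP q k l) L2 := (sphereRep hq0 hq1).comp (WP q k l).subtype
  have hρa : ρ (a q k l) = betaOp hq0 hq1 * betaOp hq0 hq1 := by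
    change sphereRep hq0 hq1 (Sphere.β q * star (Sphere.β q)) = _
    rw [map_mul, map_star, sphereRep, Sphere.lift_β, star_betaOp]
  have hρb : ρ (b q k l) = alphaOp hq0 ^ l * betaOp hq0 hq1 ^ k := by
    change sphereRep hq0 hq1 (Sphere.α q ^ l * Sphere.β q ^ k) = _
    rw [map_mul, map_pow, map_pow, sphereRep, Sphere.lift_β, Sphere.lift_α]
  refine (exists_isTeardropRep (s := s) hq0 hl hkl ρ V ?_ ?_ ?_ ?_).imp fun _ h => h.1
  · intro p
    rw [hρa, hV, Function.comp_apply, betaOp_mul_self_e, add_assoc, Nat.sub_add_cancel hs1]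
    push_cast; rfl
  · intro p
    rw [hρb, hV, hV, Function.comp_apply, Function.comp_apply, mul_apply_eq_comp, betaOp_pow_e,
      map_smul, alphaOp_pow_e hq0 l _ (by rw [mul_add]; omega), smul_smul, weight]
    rw [show l * (p + 1) + (s - 1) - l = l * p + (s - 1) by rw [mul_add]; omega]
    congr 1
    rw [add_assoc, Nat.sub_add_cancel hs1, ← pow_mul, Complex.ofReal_mul, mul_comm k]
    congr 1
    · push_cast; rfl
    · congr 1
      refine Finset.prod_congr rfl fun r _ => ?_
      congr 4
      push_cast [Nat.cast_sub hs1]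
      ring
  · rw [hρb, hV, Function.comp_apply, mul_apply_eq_comp, betaOp_pow_e, map_smul,
      alphaOp_pow_e_eq_zero hq0 l _ (by omega), smul_zero]
  · intro p
    rw [map_star, hρb, star_mul, star_pow, star_pow, star_betaOp, hV, Function.comp_apply,
      mul_apply_eq_comp]
    obtain ⟨c, hc⟩ := star_alphaOp_pow_e hq0 l (l * p + (s - 1))
    rw [hc, map_smul, betaOp_pow_e, smul_smul]
    -- Only membership in the range is required, so the coefficient c need not be known.
    refine ⟨(c * ((q : ℂ) ^ (l * p + (s - 1) + l + 1)) ^ k) • e (p + 1), ?_⟩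
    rw [map_smul, hV, Function.comp_apply, mul_add, mul_one, add_right_comm (l * p) l]

/-! ### Irreducibility and inequivalence of the π_s -/

section teardrop

variable {π : BoundedRep (WP q k l) L2}

theorem IsTeardropRep.star_b_e (h : IsTeardropRep q k l s π) (p : ℕ) :
    π (star (b q k l)) (e p) = (weight q k l s (p + 1) : ℂ) • e (p + 1) := by
  refine ext_inner_e fun j => ?_
  rw [map_star, ContinuousLinearMap.star_eq_adjoint, ContinuousLinearMap.adjoint_inner_right,
    inner_smul_right, inner_e_left, e_apply]
  rcases j with _ | j
  · rw [h.2.2]; simp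
  · rw [h.2.1 _ (by omega), inner_smul_left, Complex.conj_ofReal, Nat.add_sub_cancel, inner_e_left,
      e_apply]
    simp only [add_left_inj]
    split_ifs with hj
    · rw [hj]
    · simp

theorem IsTeardropRep.a_apply (h : IsTeardropRep q k l s π) (x : L2) (j : ℕ) :
    π (a q k l) x j = ((q ^ (2 * (l * j + s)) : ℝ) : ℂ) * x j := by
  rw [← inner_e_left, ← star_a, map_star, ContinuousLinearMap.star_eq_adjoint,
    ContinuousLinearMap.adjoint_inner_right, h.1, inner_smul_left, Complex.conj_ofReal,
    inner_e_left]

/-- Repeated application of b* reaches every basis vector, because the weights from index 1 on do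
not vanish. -/
theorem IsTeardropRep.eq_top_of_e_zero_mem (hq0 : 0 < q) (hq1 : q < 1) (hs : 1 ≤ s)
    (h : IsTeardropRep q k l s π) {K : Submodule ℂ L2} (hK : IsClosed (K : Set L2))
    (hinv : ∀ x, ∀ v ∈ K, π x v ∈ K) (h0 : e 0 ∈ K) : K = ⊤ := by
  refine eq_top_iff.2 fun x _ => mem_of_forall_e_mem hK (fun p => ?_) x
  induction p with
  | zero => exact h0
  | succ p ih =>
    have := hinv (star (b q k l)) _ ih
    rw [h.star_b_e] at this
    exact (K.smul_mem_iff (by exact_mod_cast (weight_succ_pos hq0 hq1 hs p).ne')).1 this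

theorem pow_injective (hq0 : 0 < q) (hq1 : q < 1) {m n : ℕ}
    (h : ((q ^ (2 * m) : ℝ) : ℂ) = ((q ^ (2 * n) : ℝ) : ℂ)) : m = n := by
  have := pow_right_injective₀ hq0 hq1.ne (Complex.ofReal_injective h)
  omega

theorem orthogonal_invariant {A : Type*} [Ring A] [StarRing A] [Algebra ℂ A]
    {H : Type*} [NormedAddCommGroup H] [InnerProductSpace ℂ H] [CompleteSpace H]
    {ρ : BoundedRep A H} {K : Submodule ℂ H} (hinv : ∀ x, ∀ v ∈ K, ρ x v ∈ K) (x : A) :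
    ∀ v ∈ Kᗮ, ρ x v ∈ Kᗮ := by
  intro v hv
  rw [Submodule.mem_orthogonal] at hv ⊢
  intro u hu
  rw [← star_star x, map_star, ContinuousLinearMap.star_eq_adjoint,
    ContinuousLinearMap.adjoint_inner_right]
  exact hv _ (hinv _ _ hu)

/-- Split e_0 along K and its orthogonal complement, both invariant. The K-component is again in the
q^{2s}-eigenspace of a, which is spanned by e_0, so e_0 lies in one of the two subspaces, and that
one is everything. -/
theorem IsTeardropRep.isIrreducible (hq0 : 0 < q) (hq1 : q < 1) (hl : 0 < l) (hs : 1 ≤ s)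
    (h : IsTeardropRep q k l s π) : IsIrreducibleRep π := by
  refine ⟨⟨e 0, 0, e_ne_zero 0⟩, fun K hK hinv => ?_⟩
  have : CompleteSpace K := hK.completeSpace_coe
  have hinv' := orthogonal_invariant hinv
  obtain ⟨u, hu, w, hw, huw⟩ := K.exists_add_mem_mem_orthogonal (e 0)
  set c : ℂ := ((q ^ (2 * (l * 0 + s)) : ℝ) : ℂ) with hc
  have h1 : π (a q k l) u - c • u = -(π (a q k l) w - c • w) := by
    have := h.1 0
    rw [huw, map_add, smul_add, ← hc] at this
    rw [neg_sub, sub_eq_sub_iff_add_eq_add, this, add_comm]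
  -- The defect of u lies in K and equals minus the defect of w, which lies in the complement.
  have h2 : π (a q k l) u - c • u = 0 := by
    have hm : π (a q k l) u - c • u ∈ K := sub_mem (hinv _ _ hu) (K.smul_mem _ hu)
    have hm' : π (a q k l) u - c • u ∈ Kᗮ :=
      h1 ▸ neg_mem (sub_mem (hinv' _ _ hw) (Kᗮ.smul_mem _ hw))
    exact (Submodule.disjoint_def.1 K.orthogonal_disjoint) _ hm hm'
  have h3 : u = u 0 • e 0 := by
    refine lp.ext (funext fun j => ?_)
    rw [lp.coeFn_smul, Pi.smul_apply, e_apply]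
    split_ifs with hj
    · rw [hj, smul_eq_mul, mul_one]
    · rw [smul_zero]
      have h4 : π (a q k l) u j = (c • u) j := by rw [sub_eq_zero.1 h2]
      rw [h.a_apply, lp.coeFn_smul, Pi.smul_apply, smul_eq_mul, hc] at h4
      by_contra hne
      have := pow_injective hq0 hq1 (mul_right_cancel₀ hne h4)
      have : l * j = l * 0 := by omega
      exact hj (Nat.eq_of_mul_eq_mul_left hl this)
  by_cases h0 : u 0 = 0
  · left
    rw [h0, zero_smul] at h3
    rw [h3, zero_add] at huw
    have := h.eq_top_of_e_zero_mem hq0 hq1 hs K.isClosed_orthogonal hinv' (huw ▸ hw)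
    exact (Submodule.orthogonal_eq_top_iff _).1 this
  · right
    refine h.eq_top_of_e_zero_mem hq0 hq1 hs hK hinv ((K.smul_mem_iff h0).1 ?_)
    exact h3 ▸ hu

/-- The image of e_0 is an eigenvector for q^{2s}, hence s = lj + t for some j; the bounds s ≤ l and
t ≥ 1 leave only j = 0. -/
theorem IsTeardropRep.eq_of_equivalent {t : ℕ} {π' : BoundedRep (WP q k l) L2} (hq0 : 0 < q) (hq1 : q < 1)
    (hsl : s ≤ l) (ht : 1 ≤ t)
    (h : IsTeardropRep q k l s π) (h' : IsTeardropRep q k l t π')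
    (hU : UnitarilyEquivalent π π') : s = t := by
  obtain ⟨U, hU⟩ := hU
  have h0 : U (e 0) ≠ 0 := fun h => e_ne_zero 0 (U.map_eq_zero_iff.1 h)
  obtain ⟨j, hj⟩ : ∃ j, U (e 0) j ≠ 0 := by
    by_contra! hne
    exact h0 (lp.ext (funext hne))
  have h1 := h'.a_apply (U (e 0)) j
  rw [← hU, h.1, map_smul, lp.coeFn_smul, Pi.smul_apply, smul_eq_mul] at h1
  have := pow_injective hq0 hq1 (mul_right_cancel₀ hj h1)
  rcases j with _ | j
  · omega
  · rw [mul_add] at this; omega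

end teardrop

/-! ### The spectrum of `a` in a representation -/

/-- If d⁻¹t - A were invertible, the commutation relation would make B a left multiple of t - A,
hence also f(A) = B*B. As f(A) ≡ f(t) modulo t - A and f(t) ≠ 0, t - A would have a left inverse. -/
theorem mem_spectrum_of_qcomm {R : Type*} [Ring R] [StarRing R] [Algebra ℂ R] [StarModule ℂ R]
    {A B : R} (hA : star A = A) {d : ℂ} (hd : d ≠ 0) (hBA : B * A = d • (A * B)) {f : ℂ[X]}
    (hf : star B * B = aeval A f) {t : ℂ} (ht : star t = t) (htA : t ∈ spectrum ℂ A)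
    (hft : f.eval t ≠ 0) : d⁻¹ * t ∈ spectrum ℂ A := by
  by_contra hn
  rw [spectrum.mem_iff, not_not] at hn
  obtain ⟨u, hu⟩ := hn
  have h1 : (u : R) * B = d⁻¹ • (B * (algebraMap ℂ R t - A)) := by
    rw [hu, sub_mul, mul_sub, hBA, smul_sub, smul_smul, inv_mul_cancel₀ hd, one_smul, map_mul,
      mul_assoc, ← Algebra.smul_def, ← Algebra.commutes t B]
  have h2 : B = ((u⁻¹ : Rˣ) : R) * (d⁻¹ • B) * (algebraMap ℂ R t - A) := by
    rw [mul_assoc, smul_mul_assoc, ← h1, ← mul_assoc, Units.inv_mul, one_mul]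
  obtain ⟨g, hg⟩ := X_sub_C_dvd_sub_C_eval (a := t) (p := f)
  have h3 : aeval A f = algebraMap ℂ R (f.eval t) - aeval A g * (algebraMap ℂ R t - A) := by
    have := congrArg (aeval A) (sub_eq_iff_eq_add'.1 hg)
    rw [mul_comm, map_add, map_mul, map_sub, aeval_C, aeval_X, aeval_C] at this
    rw [this, ← neg_sub A, mul_neg, sub_neg_eq_add]
  set X' : R := star B * (((u⁻¹ : Rˣ) : R) * (d⁻¹ • B)) with hX
  have h4 : aeval A f = X' * (algebraMap ℂ R t - A) := by
    rw [hX, mul_assoc, ← h2, hf]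
  have h5 : ((f.eval t)⁻¹ • (X' + aeval A g)) * (algebraMap ℂ R t - A) = 1 := by
    rw [smul_mul_assoc, add_mul, ← h4, h3, sub_add_cancel,
      Algebra.algebraMap_eq_smul_one, smul_smul, inv_mul_cancel₀ hft, one_smul]
  -- Since t is real, t - A is self-adjoint, so the adjoint of the left inverse is a right inverse.
  have h6 : star (algebraMap ℂ R t - A) = algebraMap ℂ R t - A := by
    rw [star_sub, hA, ← algebraMap_star_comm, ht]
  have h7 := congrArg star h5
  rw [star_mul, h6, star_one] at h7
  rw [spectrum.mem_iff] at htA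
  exact htA (isUnit_iff_exists.2 ⟨_, h7, left_inv_eq_right_inv h5 h7 ▸ h5⟩)

theorem aeval_apply_of_eigenvector {H : Type*} [NormedAddCommGroup H]
    [InnerProductSpace ℂ H] {A : H →L[ℂ] H} {t : ℂ} {v : H} (h : A v = t • v) (p : ℂ[X]) :
    aeval A p v = p.eval t • v := by
  induction p using Polynomial.induction_on with
  | C c => rw [aeval_C, eval_C, Algebra.algebraMap_eq_smul_one, smul_apply]; rfl
  | add p r hp hr => rw [map_add, add_apply, hp, hr, eval_add, add_smul]
  | monomial n c ih =>
    rw [pow_succ, ← mul_assoc, map_mul, aeval_X, mul_apply_eq_comp, h, map_smul, ih, smul_smul]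
    congr 1
    simp only [eval_mul, eval_X]
    ring

section rep

variable {H : Type*} [NormedAddCommGroup H] [InnerProductSpace ℂ H] [CompleteSpace H]

/-- A tent function h with h(t) = 1 vanishes on the rest of the spectrum. Then (z - t)h = 0 on the
spectrum, so h(A) maps into the eigenspace, and h(A) ≠ 0 because 1 lies in its spectrum. -/
theorem exists_eigenvector_of_isolated [Nontrivial H] {A : H →L[ℂ] H} (hA : IsStarNormal A) {t : ℂ}
    (ht : t ∈ spectrum ℂ A) {δ : ℝ} (hδ : 0 < δ)
    (hiso : ∀ z ∈ spectrum ℂ A, z ≠ t → δ ≤ ‖z - t‖) : ∃ v : H, v ≠ 0 ∧ A v = t • v := by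
  let h : ℂ → ℂ := fun z => ((max 0 (1 - ‖z - t‖ / δ) : ℝ) : ℂ)
  have hcont : Continuous h := by fun_prop
  have h1 : (A - algebraMap ℂ _ t) * cfc h A = 0 := by
    have : cfc (fun z => (z - t) * h z) A = (A - algebraMap ℂ _ t) * cfc h A := by
      rw [cfc_mul (fun z => z - t) h A (by fun_prop) hcont.continuousOn,
        cfc_sub (fun z => z) (fun _ => t) A (by fun_prop) (by fun_prop), cfc_id' ℂ A,
        cfc_const t A]
    rw [← this, cfc_congr (g := fun _ => (0 : ℂ)), cfc_const_zero]
    intro z hz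
    by_cases hzt : z = t
    · simp [hzt]
    · have := (one_le_div hδ).2 (hiso z hz hzt)
      simp only [h]
      rw [max_eq_left (by linarith)]
      simp
  have h2 : cfc h A ≠ 0 := by
    intro h0
    have h3 : h t ∈ spectrum ℂ (cfc h A) := by
      rw [cfc_map_spectrum h A hA hcont.continuousOn]
      exact ⟨t, ht, rfl⟩
    rw [h0, spectrum.zero_eq] at h3
    simp [h] at h3
  obtain ⟨x, hx⟩ : ∃ x, cfc h A x ≠ 0 := by
    by_contra! hne
    exact h2 (ContinuousLinearMap.ext hne)
  refine ⟨_, hx, ?_⟩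
  have := DFunLike.congr_fun h1 x
  rw [mul_apply_eq_comp, sub_apply, zero_apply, sub_eq_zero] at this
  rw [this, Algebra.algebraMap_eq_smul_one, smul_apply]
  rfl

variable (ρ : BoundedRep (WP q k l) H)

theorem star_map_a : star (ρ (a q k l)) = ρ (a q k l) := by
  rw [← map_star, star_a]

theorem isSelfAdjoint_map_a : IsSelfAdjoint (ρ (a q k l)) := star_map_a ρ

theorem star_map_b_mul (hq : q ≠ 0) :
    star (ρ (b q k l)) * ρ (b q k l) = aeval (ρ (a q k l)) (starMulPoly q k l) := by
  rw [← map_star, ← map_mul, star_b_mul_b hq]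
  exact (Polynomial.aeval_algHom_apply ρ.toAlgHom (a q k l) _).symm

theorem map_b_mul_star :
    ρ (b q k l) * star (ρ (b q k l)) = aeval (ρ (a q k l)) (mulStarPoly q k l) := by
  rw [← map_star, ← map_mul, b_mul_star_b]
  exact (Polynomial.aeval_algHom_apply ρ.toAlgHom (a q k l) _).symm

theorem map_b_mul_a : ρ (b q k l) * ρ (a q k l) =
    ((q : ℂ) ^ 2) ^ l • (ρ (a q k l) * ρ (b q k l)) := by
  rw [← map_mul, b_mul_a, map_smul, map_mul]

theorem map_a_mul_star_b : ρ (a q k l) * star (ρ (b q k l)) =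
    ((q : ℂ) ^ 2) ^ l • (star (ρ (b q k l)) * ρ (a q k l)) := by
  have := congrArg star (map_b_mul_a ρ)
  rw [star_mul, star_smul, star_mul, star_map_a] at this
  rw [this]
  simp

/-- Multiplying t repeatedly by q^{-2l} stays in the spectrum until f vanishes. Boundedness forces
this to happen, and at the first such n the point is some q^{2s}, whence t = q^{2(ln+s)}. -/
theorem spectrum_map_a (hq0 : 0 < q) (hq1 : q < 1) (hl : 0 < l) {t : ℂ}
    (ht : t ∈ spectrum ℂ (ρ (a q k l))) (ht0 : t ≠ 0) :
    (∃ m : ℕ, t = ((q ^ (2 * m) : ℝ) : ℂ)) ∧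
      ∃ s ∈ Finset.Icc 1 l, ((q ^ (2 * s) : ℝ) : ℂ) ∈ spectrum ℂ (ρ (a q k l)) := by
  have hq : (q : ℂ) ≠ 0 := by exact_mod_cast hq0.ne'
  set d : ℂ := ((q : ℂ) ^ 2) ^ l with hd
  have hd0 : d ≠ 0 := pow_ne_zero _ (pow_ne_zero _ hq)
  have hreal : ∀ z ∈ spectrum ℂ (ρ (a q k l)), star z = z := fun z hz => by
    rw [(isSelfAdjoint_map_a ρ).mem_spectrum_eq_re hz, Complex.star_def, Complex.conj_ofReal]
  have hstep : ∀ n, (∀ j < n, (starMulPoly q k l).eval (d⁻¹ ^ j * t) ≠ 0) →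
      d⁻¹ ^ n * t ∈ spectrum ℂ (ρ (a q k l)) := by
    intro n
    induction n with
    | zero => intro _; simpa using ht
    | succ n ih =>
      intro h
      have h1 := ih fun j hj => h j (by omega)
      rw [pow_succ', mul_assoc]
      exact mem_spectrum_of_qcomm (star_map_a ρ) hd0 (map_b_mul_a ρ) (star_map_b_mul ρ hq0.ne')
        (hreal _ h1) h1 (h n (by omega))
  have hex : ∃ n, (starMulPoly q k l).eval (d⁻¹ ^ n * t) = 0 := by
    by_contra! hne
    have hd1 : 1 < ‖d⁻¹‖ := by
      rw [norm_inv, hd, norm_pow, norm_pow, Complex.norm_real, Real.norm_of_nonneg hq0.le]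
      refine (one_lt_inv₀ (by positivity)).2 ?_
      rw [← pow_mul]
      exact pow_lt_one₀ hq0.le hq1 (by omega)
    obtain ⟨n, hn⟩ := pow_unbounded_of_one_lt
      (‖ρ (a q k l)‖ * ‖(1 : H →L[ℂ] H)‖ / ‖t‖) hd1
    have h1 := spectrum.norm_le_norm_mul_of_mem (hstep n fun j _ => hne j)
    rw [norm_mul, norm_pow] at h1
    rw [div_lt_iff₀ (norm_pos_iff.2 ht0)] at hn
    linarith
  classical
  have h1 := Nat.find_spec hex
  have h2 := hstep (Nat.find hex) fun j hj => Nat.find_min hex hj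
  set n := Nat.find hex
  obtain ⟨s, hs, h3⟩ := eq_of_eval_starMulPoly_eq_zero hq0
    (mul_ne_zero (pow_ne_zero _ (inv_ne_zero hd0)) ht0) h1
  refine ⟨⟨l * n + s, ?_⟩, s, hs, h3 ▸ h2⟩
  rw [inv_pow, inv_mul_eq_iff_eq_mul₀ (pow_ne_zero _ hd0)] at h3
  rw [h3, hd]
  push_cast
  ring

/-- The nearest other even power is q^{2s+2}, at exactly the distance on the left. -/
theorem dist_pow_ge (hq0 : 0 < q) (hq1 : q < 1) {m s : ℕ} (h : m ≠ s) :
    q ^ (2 * s) * (1 - q ^ 2) ≤ |q ^ (2 * m) - q ^ (2 * s)| := by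
  have hq2 : q ^ 2 < 1 := pow_lt_one₀ hq0.le hq1 (by omega)
  have hs := pow_pos hq0 (2 * s)
  rcases lt_or_gt_of_ne h with h | h
  · have h1 : q ^ (2 * s) ≤ q ^ (2 * m) * q ^ 2 := by
      rw [← pow_add]
      exact pow_le_pow_of_le_one hq0.le hq1.le (by omega)
    refine le_trans ?_ (le_abs_self _)
    have h2 : q ^ (2 * s) ≤ q ^ (2 * m) := pow_le_pow_of_le_one hq0.le hq1.le (by omega)
    linarith [mul_le_mul_of_nonneg_right h2 (sub_nonneg.2 hq2.le)]
  · have h1 : q ^ (2 * m) ≤ q ^ (2 * s) * q ^ 2 := by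
      rw [← pow_add]
      exact pow_le_pow_of_le_one hq0.le hq1.le (by omega)
    refine le_trans ?_ (neg_le_abs _)
    linarith

theorem exists_lowest_eigenvector [Nontrivial H] (hq0 : 0 < q) (hq1 : q < 1) (hl : 0 < l)
    (ha : ρ (a q k l) ≠ 0) : ∃ s ∈ Finset.Icc 1 l, ∃ v : H, v ≠ 0 ∧
      ρ (a q k l) v = ((q ^ (2 * s) : ℝ) : ℂ) • v := by
  have hex : ∃ t ∈ spectrum ℂ (ρ (a q k l)), t ≠ 0 := by
    by_contra! hne
    exact ha (CFC.eq_zero_of_spectrum_subset_zero (R := ℂ) _ hne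
      (isSelfAdjoint_map_a ρ).isStarNormal)
  obtain ⟨t, ht, ht0⟩ := hex
  obtain ⟨-, s, hs, hsA⟩ := spectrum_map_a ρ hq0 hq1 hl ht ht0
  have hq2 : q ^ 2 < 1 := pow_lt_one₀ hq0.le hq1 (by omega)
  have hpos := pow_pos hq0 (2 * s)
  refine ⟨s, hs, exists_eigenvector_of_isolated (isSelfAdjoint_map_a ρ).isStarNormal hsA
    (mul_pos hpos (sub_pos.2 hq2)) fun z hz hzs => ?_⟩
  -- The same gap also separates q^{2s} from 0, the accumulation point of the powers.
  by_cases hz0 : z = 0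
  · rw [hz0, zero_sub, norm_neg, Complex.norm_real, Real.norm_of_nonneg hpos.le]
    have := pow_pos hq0 2
    nlinarith
  · obtain ⟨⟨m, rfl⟩, -⟩ := spectrum_map_a ρ hq0 hq1 hl hz hz0
    rw [← Complex.ofReal_sub, Complex.norm_real]
    exact dist_pow_ge hq0 hq1 fun h => hzs (by rw [h])

/-! ### Classification -/

/-- An irreducible representation is exhausted by the range of any invariant isometry. -/
theorem unitarilyEquivalent_of_isometry {A : Type*} [Ring A] [StarRing A] [Algebra ℂ A]
    {H' : Type*} [NormedAddCommGroup H'] [InnerProductSpace ℂ H'] [CompleteSpace H']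
    [Nontrivial H'] {ρ : BoundedRep A H} (hρ : IsIrreducibleRep ρ) {π : BoundedRep A H'}
    (V : H' →ₗᵢ[ℂ] H) (hV : ∀ x v, V (π x v) = ρ x (V v)) : UnitarilyEquivalent ρ π := by
  have hclosed : IsClosed (LinearMap.range V.toLinearMap : Set H) := by
    have : IsClosed (Set.range V) := V.isometry.isClosedEmbedding.isClosed_range
    exact this
  have hsurj : Function.Surjective V := by
    rcases hρ.2 (LinearMap.range V.toLinearMap) hclosed (by
      rintro x _ ⟨v, rfl⟩
      exact ⟨π x v, hV x v⟩) with h | h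
    · obtain ⟨v, hv⟩ := exists_ne (0 : H')
      have : V v ∈ LinearMap.range V.toLinearMap := ⟨v, rfl⟩
      rw [h, Submodule.mem_bot, map_eq_zero_iff V V.injective] at this
      exact absurd this hv
    · exact LinearMap.range_eq_top.1 h
  let U := LinearIsometryEquiv.ofSurjective V hsurj
  have hU : ∀ v, U v = V v := fun _ => rfl
  refine ⟨U.symm, fun x v => ?_⟩
  rw [LinearIsometryEquiv.symm_apply_eq, hU, hV, ← hU, U.apply_symm_apply]

/-- The vectors obtained from a lowest weight vector by normalized raising. -/
def raise (s : ℕ) (v : H) : ℕ → H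
  | 0 => v
  | p + 1 => ((weight q k l s (p + 1) : ℂ)⁻¹) • star (ρ (b q k l)) (raise s v p)

theorem map_a_raise {v : H} (hv : ρ (a q k l) v = ((q ^ (2 * s) : ℝ) : ℂ) • v) (p : ℕ) :
    ρ (a q k l) (raise ρ s v p) = ((q ^ (2 * (l * p + s)) : ℝ) : ℂ) • raise ρ s v p := by
  induction p with
  | zero => rw [mul_zero, zero_add]; exact hv
  | succ p ih =>
    rw [raise, map_smul, ← mul_apply_eq_comp, map_a_mul_star_b, smul_apply, mul_apply_eq_comp, ih,
      map_smul]
    simp only [smul_smul]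
    congr 1
    push_cast
    ring

theorem map_b_star_raise (hq0 : 0 < q) (hq1 : q < 1) {v : H}
    (hv : ρ (a q k l) v = ((q ^ (2 * s) : ℝ) : ℂ) • v) (p : ℕ) :
    ρ (b q k l) (star (ρ (b q k l)) (raise ρ s v p)) =
      ((weight q k l s (p + 1) : ℂ) * weight q k l s (p + 1)) • raise ρ s v p := by
  rw [← mul_apply_eq_comp, map_b_mul_star, aeval_apply_of_eigenvector (map_a_raise ρ hv p),
    eval_mulStarPoly hq0 hq1]

theorem map_b_raise_succ (hq0 : 0 < q) (hq1 : q < 1) (hs : 1 ≤ s) {v : H}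
    (hv : ρ (a q k l) v = ((q ^ (2 * s) : ℝ) : ℂ) • v) (p : ℕ) :
    ρ (b q k l) (raise ρ s v (p + 1)) = (weight q k l s (p + 1) : ℂ) • raise ρ s v p := by
  have : (weight q k l s (p + 1) : ℂ) ≠ 0 := by
    exact_mod_cast (weight_succ_pos hq0 hq1 hs p).ne'
  rw [raise, map_smul, map_b_star_raise ρ hq0 hq1 hv, smul_smul, inv_mul_cancel_left₀ this]

/-- The eigenvalue of bb* at level p is the squared weight, so dividing by the weight keeps the
norm. -/
theorem inner_raise_succ (hq0 : 0 < q) (hq1 : q < 1) (hs : 1 ≤ s) {v : H}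
    (hv : ρ (a q k l) v = ((q ^ (2 * s) : ℝ) : ℂ) • v) (p : ℕ) :
    inner ℂ (raise ρ s v (p + 1)) (raise ρ s v (p + 1)) =
      inner ℂ (raise ρ s v p) (raise ρ s v p) := by
  have hw : (weight q k l s (p + 1) : ℂ) ≠ 0 := by
    exact_mod_cast (weight_succ_pos hq0 hq1 hs p).ne'
  nth_rw 1 [raise]
  rw [inner_smul_left, ContinuousLinearMap.star_eq_adjoint, ContinuousLinearMap.adjoint_inner_left,
    map_b_raise_succ ρ hq0 hq1 hs hv, inner_smul_right, map_inv₀, Complex.conj_ofReal,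
    inv_mul_cancel_left₀ hw]

/-- Distinct levels are eigenvectors of the self-adjoint operator of a for distinct eigenvalues,
hence orthogonal. -/
theorem orthonormal_raise (hq0 : 0 < q) (hq1 : q < 1) (hl : 0 < l) (hs : 1 ≤ s) {v : H}
    (hv : ρ (a q k l) v = ((q ^ (2 * s) : ℝ) : ℂ) • v) (hv1 : ‖v‖ = 1) :
    Orthonormal ℂ (raise ρ s v) := by
  rw [orthonormal_iff_ite]
  intro i j
  split_ifs with hij
  · subst hij
    induction i with
    | zero => rw [raise, inner_self_eq_norm_sq_to_K, hv1]; simp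
    | succ i ih => rw [inner_raise_succ ρ hq0 hq1 hs hv, ih]
  · by_contra hne
    have h1 : inner ℂ (ρ (a q k l) (raise ρ s v i)) (raise ρ s v j) =
        inner ℂ (raise ρ s v i) (ρ (a q k l) (raise ρ s v j)) := by
      rw [← ContinuousLinearMap.adjoint_inner_right, ← ContinuousLinearMap.star_eq_adjoint,
        star_map_a]
    rw [map_a_raise ρ hv, map_a_raise ρ hv, inner_smul_left, inner_smul_right,
      Complex.conj_ofReal] at h1
    have := pow_injective hq0 hq1 (mul_right_cancel₀ hne h1)
    have : l * i = l * j := by omega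
    exact hij (Nat.eq_of_mul_eq_mul_left hl this)

/-- The squared norm of bv is ⟨v, f(a)v⟩, and f(q^{2s}) = 0. -/
theorem map_b_eq_zero_of_lowest (hq0 : 0 < q) (hs1 : 1 ≤ s) (hsl : s ≤ l) {v : H}
    (hv : ρ (a q k l) v = ((q ^ (2 * s) : ℝ) : ℂ) • v) : ρ (b q k l) v = 0 := by
  rw [← inner_self_eq_zero (𝕜 := ℂ), ← ContinuousLinearMap.adjoint_inner_right,
    ← ContinuousLinearMap.star_eq_adjoint, ← mul_apply_eq_comp, star_map_b_mul ρ hq0.ne',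
    aeval_apply_of_eigenvector hv, eval_starMulPoly_eq_zero hq0 hs1 hsl, zero_smul,
    inner_zero_right]

theorem exists_equivalent_teardropRep (hq0 : 0 < q) (hq1 : q < 1) (hl : 0 < l)
    (hkl : Nat.Coprime k l) (hρ : IsIrreducibleRep ρ) (ha : ρ (a q k l) ≠ 0) :
    ∃ s ∈ Finset.Icc 1 l, ∃ π : BoundedRep (WP q k l) L2,
      IsTeardropRep q k l s π ∧ UnitarilyEquivalent ρ π := by
  have : Nontrivial H := hρ.1
  have : Nontrivial L2 := ⟨e 0, 0, e_ne_zero 0⟩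
  obtain ⟨s, hs, v, hv0, hv⟩ := exists_lowest_eigenvector ρ hq0 hq1 hl ha
  obtain ⟨hs1, hsl⟩ := Finset.mem_Icc.1 hs
  set w : H := ((‖v‖ : ℂ)⁻¹) • v with hw
  have hw1 : ‖w‖ = 1 := norm_smul_inv_norm hv0
  have hwa : ρ (a q k l) w = ((q ^ (2 * s) : ℝ) : ℂ) • w := by
    rw [hw, map_smul, hv, smul_comm]
  have hV := basisIsometry_e (orthonormal_raise ρ hq0 hq1 hl hs1 hwa hw1)
  set V := basisIsometry (orthonormal_raise ρ hq0 hq1 hl hs1 hwa hw1)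
  obtain ⟨π, hπ, hVπ⟩ := exists_isTeardropRep (s := s) hq0 hl hkl ρ V
    (fun p => by rw [hV]; exact map_a_raise ρ hwa p)
    (fun p => by rw [hV, hV]; exact map_b_raise_succ ρ hq0 hq1 hs1 hwa p)
    (by rw [hV]; exact map_b_eq_zero_of_lowest ρ hq0 hs1 hsl hwa)
    (fun p => by
      have hw : (weight q k l s (p + 1) : ℂ) ≠ 0 := by
        exact_mod_cast (weight_succ_pos hq0 hq1 hs1 p).ne'
      refine ⟨(weight q k l s (p + 1) : ℂ) • e (p + 1), ?_⟩
      rw [map_smul, hV, hV, raise, smul_smul, mul_inv_cancel₀ hw, one_smul, map_star])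
  exact ⟨s, hs, π, hπ, unitarilyEquivalent_of_isometry hρ V hVπ⟩

/-- Since k > 0, f has no constant term, so b*b = f(0) = 0. -/
theorem map_b_eq_zero (hq : q ≠ 0) (hk : 0 < k) (ha : ρ (a q k l) = 0) : ρ (b q k l) = 0 := by
  rw [← CStarRing.star_mul_self_eq_zero_iff, star_map_b_mul ρ hq, ha, starMulPoly, map_mul, map_pow,
    aeval_X, zero_pow hk.ne', mul_zero]

theorem exists_map_eq_algebraMap (hq : q ≠ 0) (hl : 0 < l) (hkl : Nat.Coprime k l)
    (ha : ρ (a q k l) = 0) (hb : ρ (b q k l) = 0) (x : WP q k l) :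
    ∃ c : ℂ, ρ x = algebraMap ℂ _ c := by
  refine WP_induction (P := fun x => ∃ c : ℂ, ρ x = algebraMap ℂ _ c) hq hl hkl
    ⟨0, by rw [ha, map_zero]⟩ ⟨0, by rw [hb, map_zero]⟩ ?_ ?_ ?_ ?_ x
  · exact fun c => ⟨c, AlgHomClass.commutes ρ c⟩
  · rintro x y ⟨c, hc⟩ ⟨d, hd⟩
    exact ⟨c + d, by rw [map_add, hc, hd, map_add]⟩
  · rintro x y ⟨c, hc⟩ ⟨d, hd⟩
    exact ⟨c * d, by rw [map_mul, hc, hd, map_mul]⟩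
  · rintro x ⟨c, hc⟩
    exact ⟨star c, by rw [map_star, hc, algebraMap_star_comm]⟩

/-- Everything acts by scalars, so any line is invariant and irreducibility makes it the whole
space. -/
theorem exists_equivalent_character (hq : q ≠ 0) (hk : 0 < k) (hl : 0 < l)
    (hkl : Nat.Coprime k l) (hρ : IsIrreducibleRep ρ) (ha : ρ (a q k l) = 0) :
    ∃ π : BoundedRep (WP q k l) ℂ, (π (a q k l) = 0 ∧ π (b q k l) = 0) ∧
      UnitarilyEquivalent ρ π := by
  have : Nontrivial H := hρ.1
  obtain ⟨v, hv0⟩ := exists_ne (0 : H)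
  have hb := map_b_eq_zero ρ hq hk ha
  let V : ℂ →ₗᵢ[ℂ] H := LinearIsometry.toSpanSingleton ℂ H (norm_smul_inv_norm (𝕜 := ℂ) hv0)
  obtain ⟨π, hπ⟩ := exists_rep_of_invariant ρ V fun x z => by
    obtain ⟨c, hc⟩ := exists_map_eq_algebraMap ρ hq hl hkl ha hb x
    refine ⟨c • z, ?_⟩
    rw [hc, Algebra.algebraMap_eq_smul_one, smul_apply, map_smul]
    rfl
  have hzero : ∀ x, ρ x = 0 → π x = 0 := fun x hx => ContinuousLinearMap.ext fun z =>
    V.injective (by rw [hπ, hx, zero_apply, zero_apply, map_zero])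
  exact ⟨π, ⟨hzero _ ha, hzero _ hb⟩, unitarilyEquivalent_of_isometry hρ V hπ⟩

end rep

/-! ### The one-dimensional representation -/

theorem exists_character (q : ℝ) (hk : 0 < k) :
    ∃ π : BoundedRep (WP q k l) ℂ, π (a q k l) = 0 ∧ π (b q k l) = 0 := by
  -- The character α ↦ 1, β ↦ 0 of the sphere algebra.
  let χ : BoundedRep (Sphere q) ℂ := Sphere.lift q 1 0 (by simp) (by simp) (by simp) (by simp)
    (by simp)
  refine ⟨χ.comp (WP q k l).subtype, ?_, ?_⟩
  · change χ (Sphere.β q * star (Sphere.β q)) = 0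
    rw [map_mul, Sphere.lift_β, zero_mul]
  · change χ (Sphere.α q ^ l * Sphere.β q ^ k) = 0
    rw [map_mul, map_pow _ (Sphere.β q), Sphere.lift_β, zero_pow hk.ne', mul_zero]

theorem isIrreducible_character (π : BoundedRep (WP q k l) ℂ) : IsIrreducibleRep π :=
  ⟨inferInstance, fun K _ _ => eq_bot_or_eq_top K⟩

end QuantumTeardrop

end

/-! ### Assembling the classification -/

open QuantumTeardrop in
theorem proposition2p2 (q : ℝ) (hq0 : 0 < q) (hq1 : q < 1) (k l : ℕ) (hk : 0 < k) (hl : 0 < l)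
    (hkl : Nat.Coprime k l) :
    ∃ (π₀ : BoundedRep (WP q k l) ℂ) (π : ℕ → BoundedRep (WP q k l) L2),
      -- `π₀` is the one and only representation on `ℂ` with `a, b ↦ 0`
      (∀ ρ : BoundedRep (WP q k l) ℂ, ρ = π₀ ↔ (ρ (a q k l) = 0 ∧ ρ (b q k l) = 0)) ∧
      -- `π s` is the one and only representation on `ℓ²(ℕ)` given by the stated formulas
      (∀ s ∈ Finset.Icc 1 l, ∀ ρ : BoundedRep (WP q k l) L2, ρ = π s ↔ IsTeardropRep q k l s ρ) ∧
      -- the listed representations are irreducible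
      IsIrreducibleRep π₀ ∧ (∀ s ∈ Finset.Icc 1 l, IsIrreducibleRep (π s)) ∧
      -- they are pairwise inequivalent
      (∀ s ∈ Finset.Icc 1 l, ¬ UnitarilyEquivalent π₀ (π s)) ∧
      (∀ s ∈ Finset.Icc 1 l, ∀ t ∈ Finset.Icc 1 l,
        UnitarilyEquivalent (π s) (π t) → s = t) ∧
      -- every irreducible representation is equivalent to one of them
      (∀ (H : Type*) [NormedAddCommGroup H] [InnerProductSpace ℂ H] [CompleteSpace H]
        (ρ : BoundedRep (WP q k l) H), IsIrreducibleRep ρ →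
          UnitarilyEquivalent ρ π₀ ∨
            ∃ s ∈ Finset.Icc 1 l, UnitarilyEquivalent ρ (π s)) := by
  have hq : q ≠ 0 := hq0.ne'
  obtain ⟨π₀, hπ₀⟩ := exists_character (l := l) q hk
  have hex : ∀ s, ∃ π : BoundedRep (WP q k l) L2, s ∈ Finset.Icc 1 l → IsTeardropRep q k l s π := by
    intro s
    by_cases hs : s ∈ Finset.Icc 1 l
    · obtain ⟨π, hπ⟩ := exists_teardropRep hq0 hq1 hl hkl (Finset.mem_Icc.1 hs).1
        (Finset.mem_Icc.1 hs).2
      exact ⟨π, fun _ => hπ⟩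
    -- Outside 1, …, l the family takes an irrelevant value, here the representation for s = 1.
    · obtain ⟨π, -⟩ := exists_teardropRep hq0 hq1 hl hkl le_rfl hl
      exact ⟨π, fun h => absurd h hs⟩
  choose π hπ using hex
  refine ⟨π₀, π, fun ρ => ⟨?_, fun h => ?_⟩, fun s hs ρ => ⟨?_, fun h => ?_⟩,
    isIrreducible_character π₀, fun s hs => ?_, fun s hs => ?_, fun s hs t ht hU => ?_, ?_⟩
  · rintro rfl
    exact hπ₀
  · exact WP_hom_ext hq hl hkl (by rw [h.1, hπ₀.1]) (by rw [h.2, hπ₀.2])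
  · rintro rfl
    exact hπ s hs
  · exact isTeardropRep_unique hq0 hl hkl h (hπ s hs)
  · exact (hπ s hs).isIrreducible hq0 hq1 hl (Finset.mem_Icc.1 hs).1
  · rintro ⟨U, hU⟩
    -- An equivalence would force π_s(a) e_0 = 0, but its eigenvalue there is q^{2s} ≠ 0.
    have h1 := hU (a q k l) (U.symm (e 0))
    rw [hπ₀.1, zero_apply, map_zero, U.apply_symm_apply, (hπ s hs).1] at h1
    have h2 : ((q ^ (2 * (l * 0 + s)) : ℝ) : ℂ) ≠ 0 := by exact_mod_cast pow_ne_zero _ hq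
    exact (smul_ne_zero h2 (e_ne_zero 0)) h1.symm
  · exact (hπ s hs).eq_of_equivalent hq0 hq1 (Finset.mem_Icc.1 hs).2 (Finset.mem_Icc.1 ht).1
      (hπ t ht) hU
  · intro H _ _ _ ρ hρ
    by_cases ha : ρ (a q k l) = 0
    · obtain ⟨π', h, hU⟩ := exists_equivalent_character ρ hq hk hl hkl hρ ha
      left
      rwa [WP_hom_ext hq hl hkl (h.1.trans hπ₀.1.symm) (h.2.trans hπ₀.2.symm)] at hU
    · obtain ⟨s, hs, π', h, hU⟩ := exists_equivalent_teardropRep ρ hq0 hq1 hl hkl hρ ha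
      right
      refine ⟨s, hs, ?_⟩
      rwa [isTeardropRep_unique hq0 hl hkl h (hπ s hs)] at hU
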